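/- **Notation.** Let $0<|q|<1$, $(x)_0=1$, $(x)_n=\prod_{j=0}^{n-1}(1-xq^j)$, $(x)_\infty=\prod_{j\ge0}(1-xq^j)$, $(x_1,\dots,x_m)_n=\prod_i (x_i)_n$ for $n$ finite or $\infty$. The function $${}_{s+1}\phi_s\left({a_1,\dots,a_{s+1}\atop b_1,\dots,b_s};z\right)=\sum_{n\ge0}\frac{(a_1,\dots,a_{s+1})_n}{(b_1,\dots,b_s,q)_n}z^n ,\qquad |z|<1,$$ is understood for other $z\notin\{q^{-k}:k\ge0\}$ as the analytic continuation in $z$. Put $${}_8W_7(a;b,c,d,e,f;z)={}_8\phi_7\left({a,q\sqrt a,-q\sqrt a,b,c,d,e,f\atop \sqrt a,-\sqrt a,\frac{aq}b,\frac{aq}c,\frac{aq}d,\frac{aq}e,\frac{aq}f};z\right),$$ used with $z=a^2q^2/(bcdef)$. Let $a,b,c,d,e,h$ be nonzero complex numbers and consider the recurrence $Y_{n+1}-c_nY_n+d_nY_{n-1}=0$ $(n\ge1)$, where $d_n=C_{n-1}D_n$ and $$c_n=C_n+D_n+\frac{a^2q^{2n+2}}{bcdeh^2}\,\frac{(1-b)(1-c)(1-d)(1-e)}{1-\frac{aq^{n+1}}h},$$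 $$C_n=-\frac{(1-\frac{aq^{n+1}}{bh})(1-\frac{aq^{n+1}}{ch})(1-\frac{aq^{n+1}}{dh})(1-\frac{aq^{n+1}}{eh})}{1-\frac{aq^{n+1}}h},\qquad D_n=-q\left(1-\frac{q^n}h\right)\left(1-\frac{aq^n}h\right)\left(1-\frac{a^2q^{n+1}}{bcdeh}\right).$$ Let $$Y_n^{(1)}=\frac{(-1)^n(\frac{aq^{n+1}}h)_\infty}{(\frac{aq^{n+1}}{bh},\frac{aq^{n+1}}{ch},\frac{aq^{n+1}}{dh},\frac{aq^{n+1}}{eh})_\infty}\,{}_8W_7\left(a;b,c,d,e,hq^{-n};\frac{a^2q^{n+2}}{bcdeh}\right),$$ $$Y_n^{(3)}=\frac{(-1)^n(\frac{aq^{n+1}}h)_\infty}{(\frac{aq^{n+1}}{bh},\frac{aq^{n+1}}{ch},\frac{aq^{n+1}}{dh},\frac{aq^{n+1}}{eh})_\infty}\,{}_8W_7\left(\frac{bcde}{aq};b,c,d,e,\frac{bcdehq^{-n-1}}{a^2};\frac{q^{n+1}}h\right),$$ $$C_1=\frac{(aq,\frac{aq}{de})_\infty}{(\frac{aq}d,\frac{aq}e)_\infty}\,{}_3\phi_2\left({\frac{aq}{bc},d,e\atop\frac{aq}b,\frac{aq}c};\frac{aq}{de}\right),\qquad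 C_3=\frac{(\frac{bcde}a,\frac{bc}a)_\infty}{(\frac{bcd}a,\frac{bce}a)_\infty}\,{}_3\phi_2\left({\frac{de}a,d,e\atop\frac{cde}a,\frac{bde}a};\frac{bc}a\right),$$ $$Y_n^{(\min)}=C_3Y_n^{(1)}-C_1Y_n^{(3)} .$$ **Assumptions (no singularities).** For all integers $k\ge0$ and all $x\in\{b,c,d,e\}$: $aq^{2k}\ne1$; $aq^{k+1}\notin\{x,\,h,\,xh,\,de\}$; $a^2q^{k+2}\ne bcdeh$; $q^{k+1}\ne h$; $bcdeq^{2k}\ne aq$; and $a\notin\{bcdq^k,bceq^k,bdeq^k,cdeq^k,bcq^k\}$. Moreover $c_0Y_0^{(\min)}-Y_1^{(\min)}\ne0$. **Theorem 5.1.** $(Y_n^{(\min)})_{n\ge0}$ is a minimal solution of the recurrence: it is a nonzero solution, and $Y_n^{(\min)}/Z_n\to0$ for every solution $(Z_n)$ that is not a constant multiple of it. The continued fraction with coefficients $c_n,d_n$ converges, and $$\frac1{c_0}\genfrac{}{}{0pt}{}{}{-}\frac{d_1}{c_1}\genfrac{}{}{0pt}{}{}{-}\frac{d_2}{c_2}\genfrac{}{}{0pt}{}{}{-\cdots}=\frac{Y_0^{(\min)}}{c_0Y_0^{(\min)}-Y_1^{(\min)}}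 .$$ If moreover $h\ne1$, $a\ne h$, and for all $k\ge0$ and $x\in\{b,c,d,e\}$ one has $xq^k\ne h$, $aq^k\ne h^2q$ and $bcdehq^k\ne a^2q$, then this value equals $$-\frac1{q(1-\frac1h)(1-\frac{a^2q}{bcdeh})(1-\frac ah)}\cdot\frac{N}{M},$$ where $$N=C_3\,{}_8W_7\left(a;b,c,d,e,h;\frac{a^2q^2}{bcdeh}\right)-C_1\frac{(\frac{bcde}a,\frac{bcdeh}{a^2q},\frac{bq}h,\frac{cq}h,\frac{dq}h,\frac{eq}h)_\infty}{(\frac{bde}a,\frac{bce}a,\frac{bcd}a,\frac{cde}a,\frac{aq^2}{h^2},\frac qh)_\infty}\,{}_8W_7\left(\frac{aq}{h^2};\frac{aq}{bh},\frac{aq}{ch},\frac{aq}{dh},\frac{aq}{eh},\frac qh;\frac{bcdeh}{a^2q}\right),$$ $$M=C_3\,{}_8W_7\left(a;b,c,d,e,hq;\frac{a^2q}{bcdeh}\right)-C_1\frac{(\frac{bcde}a,\frac{bcdeh}{a^2},\frac bh,\frac ch,\frac dh,\frac eh)_\infty}{(\frac{bde}a,\frac{bce}a,\frac{bcd}a,\frac{cde}a,\frac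 a{h^2},\frac1h)_\infty}\,{}_8W_7\left(\frac a{h^2q};\frac a{bh},\frac a{ch},\frac a{dh},\frac a{eh},\frac1h;\frac{bcdeh}{a^2}\right),$$ and $M\ne0$. -/

import Mathlib

open Filter Topology

/-- The finite `q`-shifted factorial `(x)_n = ∏_{j=0}^{n-1} (1 - x q^j)`. -/
def qPoch (q x : ℂ) (n : ℕ) : ℂ := ∏ j ∈ Finset.range n, (1 - x * q ^ j)

/-- The infinite product `(x)_∞ = ∏_{j≥0} (1 - x q^j)` (convergent for `‖q‖ < 1`). -/
noncomputable def qPochInf (q x : ℂ) : ℂ := ∏' j : ℕ, (1 - x * q ^ j)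

/-- `(x₁, …, x_m)_∞ = (x₁)_∞ ⋯ (x_m)_∞`. -/
noncomputable def qPochInfs (q : ℂ) (xs : List ℂ) : ℂ := (xs.map (qPochInf q)).prod

/-- The coefficient of `z^n` in `_{s+1}φ_s(as; bs; z)`, i.e.
`(a₁, …, a_{s+1})_n / (b₁, …, b_s, q)_n`. For `r = s + 1` the factor
`[(-1)^n q^{n(n-1)/2}]^{1+s-r}` of the general series is `1`. -/
noncomputable def phiCoeff (q : ℂ) (as bs : List ℂ) (n : ℕ) : ℂ :=
  (as.map fun x => qPoch q x n).prod / ((bs.map fun x => qPoch q x n).prod * qPoch q q n)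

/-- `g` is the analytic continuation, from the open unit disc to the plane punctured at the points
`q^{-k}`, `k ≥ 0`, of the basic hypergeometric series `z ↦ _{s+1}φ_s(as; bs; z)`. These points are
the only possible singularities; the punctured plane is connected, so `g` is unique there. -/
def IsPhiContinuation (q : ℂ) (as bs : List ℂ) (g : ℂ → ℂ) : Prop :=
  DifferentiableOn ℂ g {z : ℂ | ∀ k : ℕ, z * q ^ k ≠ 1} ∧
    ∀ z : ℂ, ‖z‖ < 1 → HasSum (fun n : ℕ => phiCoeff q as bs n * z ^ n) (g z)

open Classical in
/-- The basic hypergeometric function `_{s+1}φ_s(as; bs; z)`: the sum of the series for `‖z‖ < 1`,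
and its analytic continuation in `z` otherwise. (The continuation exists whenever `0 < ‖q‖ < 1` and
no lower parameter is of the form `q^{-k}`, `k ≥ 0`.) -/
noncomputable def phi (q : ℂ) (as bs : List ℂ) (z : ℂ) : ℂ :=
  if H : ∃ g : ℂ → ℂ, IsPhiContinuation q as bs g then H.choose z else 0

/-- The very-well-poised series `₈W₇(a; b, c, d, e, f; z)`, used with `z = a²q²/(bcdef)`. The choice
of the square root of `a` is immaterial. -/
noncomputable def W87 (q a b c d e f z : ℂ) : ℂ :=
  phi q [a, q * a ^ (1 / 2 : ℂ), -(q * a ^ (1 / 2 : ℂ)), b, c, d, e, f]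
    [a ^ (1 / 2 : ℂ), -a ^ (1 / 2 : ℂ), a * q / b, a * q / c, a * q / d, a * q / e, a * q / f] z

/-- The coefficient `C_n`. -/
noncomputable def recC (q a b c d e h : ℂ) (n : ℤ) : ℂ :=
  -((1 - a * q ^ (n + 1) / (b * h)) * (1 - a * q ^ (n + 1) / (c * h)) *
      (1 - a * q ^ (n + 1) / (d * h)) * (1 - a * q ^ (n + 1) / (e * h)) /
    (1 - a * q ^ (n + 1) / h))

/-- The coefficient `D_n`. -/
noncomputable def recD (q a b c d e h : ℂ) (n : ℤ) : ℂ :=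
  -(q * (1 - q ^ n / h) * (1 - a * q ^ n / h) *
    (1 - a ^ 2 * q ^ (n + 1) / (b * c * d * e * h)))

/-- The coefficient `c_n` of the recurrence `Y_{n+1} - c_n Y_n + d_n Y_{n-1} = 0`. -/
noncomputable def reccn (q a b c d e h : ℂ) (n : ℤ) : ℂ :=
  recC q a b c d e h n + recD q a b c d e h n +
    a ^ 2 * q ^ (2 * n + 2) / (b * c * d * e * h ^ 2) *
      ((1 - b) * (1 - c) * (1 - d) * (1 - e) / (1 - a * q ^ (n + 1) / h))

/-- The coefficient `d_n = C_{n-1} D_n` of the recurrence. -/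
noncomputable def recdn (q a b c d e h : ℂ) (n : ℤ) : ℂ :=
  recC q a b c d e h (n - 1) * recD q a b c d e h n

/-- The common prefactor of `Y_n^{(1)}` and `Y_n^{(3)}`. -/
noncomputable def solPre (q a b c d e h : ℂ) (n : ℤ) : ℂ :=
  (-1) ^ n * qPochInf q (a * q ^ (n + 1) / h) /
    qPochInfs q [a * q ^ (n + 1) / (b * h), a * q ^ (n + 1) / (c * h),
      a * q ^ (n + 1) / (d * h), a * q ^ (n + 1) / (e * h)]

/-- The solution `Y_n^{(1)}`. -/
noncomputable def sol1 (q a b c d e h : ℂ) (n : ℤ) : ℂ :=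
  solPre q a b c d e h n *
    W87 q a b c d e (h * q ^ (-n)) (a ^ 2 * q ^ (n + 2) / (b * c * d * e * h))

/-- The solution `Y_n^{(3)}`. -/
noncomputable def sol3 (q a b c d e h : ℂ) (n : ℤ) : ℂ :=
  solPre q a b c d e h n *
    W87 q (b * c * d * e / (a * q)) b c d e (b * c * d * e * h * q ^ (-n - 1) / a ^ 2)
      (q ^ (n + 1) / h)

/-- The constant `C_1`, the limit of `(-1)^n Y_n^{(1)}`. -/
noncomputable def constC1 (q a b c d e : ℂ) : ℂ :=
  qPochInfs q [a * q, a * q / (d * e)] / qPochInfs q [a * q / d, a * q / e] *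
    phi q [a * q / (b * c), d, e] [a * q / b, a * q / c] (a * q / (d * e))

/-- The constant `C_3`, the limit of `(-1)^n Y_n^{(3)}`. -/
noncomputable def constC3 (q a b c d e : ℂ) : ℂ :=
  qPochInfs q [b * c * d * e / a, b * c / a] / qPochInfs q [b * c * d / a, b * c * e / a] *
    phi q [d * e / a, d, e] [c * d * e / a, b * d * e / a] (b * c / a)

/-- `Y_n^{(min)} = C_3 Y_n^{(1)} - C_1 Y_n^{(3)}`. -/
noncomputable def solMin (q a b c d e h : ℂ) (n : ℤ) : ℂ :=
  constC3 q a b c d e * sol1 q a b c d e h n - constC1 q a b c d e * sol3 q a b c d e h n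

/-- `(Y_n)_{n ≥ 0}` solves `Y_{n+1} - γ_n Y_n + δ_n Y_{n-1} = 0` for all `n ≥ 1`. -/
def SolvesRec (γ δ Y : ℕ → ℂ) : Prop :=
  ∀ n : ℕ, Y (n + 2) - γ (n + 1) * Y (n + 1) + δ (n + 1) * Y n = 0

/-- `Y` is a minimal solution: a nonzero solution such that `Y_n / Z_n → 0` for every solution `Z`
that is not a constant multiple of `Y`. -/
def IsMinimalSolution (γ δ Y : ℕ → ℂ) : Prop :=
  SolvesRec γ δ Y ∧ (∃ n, Y n ≠ 0) ∧
    ∀ Z : ℕ → ℂ, SolvesRec γ δ Z → (¬ ∃ t : ℂ, ∀ n, Z n = t * Y n) →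
      (∀ᶠ n in atTop, Z n ≠ 0) ∧ Tendsto (fun n => Y n / Z n) atTop (𝓝 0)

/-- The continued fraction `1/γ_0 - δ_1/γ_1 - δ_2/γ_2 - ⋯`. -/
def recFrac (γ δ : ℕ → ℂ) : GenContFract ℂ where
  h := 0
  s := Stream'.Seq.ofStream (fun n : ℕ => ⟨if n = 0 then 1 else -δ n, γ n⟩)

/-- The continued fraction `g` converges to the finite value `v`: its approximants
`A_n / B_n` are eventually defined and tend to `v`. -/
def FracConvergesTo (g : GenContFract ℂ) (v : ℂ) : Prop :=
  (∀ᶠ n in atTop, g.dens n ≠ 0) ∧ Tendsto (fun n : ℕ => g.convs n) atTop (𝓝 v)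

/-- The numerator of the explicit value of the continued fraction. -/
noncomputable def valNum (q a b c d e h : ℂ) : ℂ :=
  constC3 q a b c d e * W87 q a b c d e h (a ^ 2 * q ^ 2 / (b * c * d * e * h)) -
    constC1 q a b c d e *
      (qPochInfs q [b * c * d * e / a, b * c * d * e * h / (a ^ 2 * q),
          b * q / h, c * q / h, d * q / h, e * q / h] /
        qPochInfs q [b * d * e / a, b * c * e / a, b * c * d / a, c * d * e / a,
          a * q ^ 2 / h ^ 2, q / h]) *
      W87 q (a * q / h ^ 2) (a * q / (b * h)) (a * q / (c * h)) (a * q / (d * h))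
        (a * q / (e * h)) (q / h) (b * c * d * e * h / (a ^ 2 * q))

/-- The denominator of the explicit value of the continued fraction. -/
noncomputable def valDen (q a b c d e h : ℂ) : ℂ :=
  constC3 q a b c d e * W87 q a b c d e (h * q) (a ^ 2 * q / (b * c * d * e * h)) -
    constC1 q a b c d e *
      (qPochInfs q [b * c * d * e / a, b * c * d * e * h / a ^ 2,
          b / h, c / h, d / h, e / h] /
        qPochInfs q [b * d * e / a, b * c * e / a, b * c * d / a, c * d * e / a,
          a / h ^ 2, 1 / h]) *
      W87 q (a / (h ^ 2 * q)) (a / (b * h)) (a / (c * h)) (a / (d * h))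
        (a / (e * h)) (1 / h) (b * c * d * e * h / a ^ 2)

/-! Everything is written in terms of the reciprocal parameter F = 1/f. The function `wSum`, that is
W(a; b, c, d, e, 1/F; a²q²F/(bcde)), is holomorphic at F = 0, and n and h enter the recurrence only
through F = q^n/h. Up to the prefactor, whose ratio is C_n, the recurrence is the three-term
contiguous relation between F/q, F and Fq (`wSum_contiguous`). It holds for F = q^N because the
partial sums telescope (`sum_contiguous`); since q^N accumulates at 0, the identity theorem extends
it to all regular F. The involution a ↦ bcde/(aq), F ↦ a²qF/(bcde) preserves all three coefficients
(`ctg_involution`), so Y^(3) is a solution because Y^(1) is.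

As n → ∞, F → 0, and the value at F = 0 is a ₃φ₂ (`wSum_zero`). Hence (-1)^n Y^(1) → C_1 and (-1)^n
Y^(3) → C_3, so (-1)^n Y^(min) → C_3 C_1 - C_1 C_3 = 0. Since Y^(min) is nonzero, C_1 or C_3 is
nonzero, and the corresponding solution dominates Y^(min) (`isMinimalSolution_of_tendsto`).
Pincherle's theorem then gives the continued fraction.

For the explicit value, the contiguous relation at F = 1/h turns c_0 Y_0 - Y_1 into D_0 times the
same combination at F = 1/(hq). The function behind Y^(3) is moved to base aq/h² by applying a
two-term transformation twice (`wSum_transform₂`). That transformation follows, for F = q^N, from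
comparing recurrences in N, and again extends by the identity theorem.

All of this requires holomorphy in the parameters, also where the series diverges. The term ratio is
rational in q^n, so the series obeys a q-difference equation that continues it explicitly
(`differentiableOn_contVal`). -/

/-! ### Infinite products and extension principles. -/

/-- No factor of `(x)_∞` vanishes. -/
def Reg (q x : ℂ) : Prop := ∀ k : ℕ, x * q ^ k ≠ 1

lemma reg_zero (q : ℂ) : Reg q 0 := fun k => by simp

lemma Reg.ne_one {q x : ℂ} (hx : Reg q x) : x ≠ 1 := by simpa using hx 0

lemma Reg.mul_pow {q x : ℂ} (hx : Reg q x) (n : ℕ) : Reg q (x * q ^ n) := fun k => by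
  rw [mul_assoc, ← pow_add]; exact hx _

lemma Reg.mul_self {q x : ℂ} (hx : Reg q x) : Reg q (x * q) := by simpa using hx.mul_pow 1

lemma Reg.sq {q x : ℂ} (hx : Reg q x) : Reg (q ^ 2) x := fun k => by
  rw [← pow_mul]; exact hx _

lemma reg_of_mul {q x : ℂ} (h1 : x ≠ 1) (hx : Reg q (x * q)) : Reg q x := fun k => by
  cases k with
  | zero => simpa using h1
  | succ k => have := hx k; rwa [mul_assoc, ← pow_succ'] at this

lemma summable_norm_neg_mul_pow {q : ℂ} (hq : ‖q‖ < 1) (x : ℂ) :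
    Summable fun j : ℕ => ‖-(x * q ^ j)‖ := by
  simpa [norm_mul, norm_pow] using
    (summable_geometric_of_lt_one (norm_nonneg q) hq).mul_left ‖x‖

lemma multipliable_qPochInf {q : ℂ} (hq : ‖q‖ < 1) (x : ℂ) :
    Multipliable fun j : ℕ => 1 - x * q ^ j := by
  simpa [sub_eq_add_neg] using
    multipliable_one_add_of_summable (summable_norm_neg_mul_pow hq x)

lemma qPochInf_ne_zero {q x : ℂ} (hq : ‖q‖ < 1) (hx : Reg q x) : qPochInf q x ≠ 0 := by
  have := tprod_one_add_ne_zero_of_summable (f := fun j : ℕ => -(x * q ^ j))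
    (fun i => by rw [← sub_eq_add_neg]; exact sub_ne_zero.2 (hx i).symm)
    (summable_norm_neg_mul_pow hq x)
  simpa [qPochInf, sub_eq_add_neg] using this

lemma qPochInf_eq_mul {q : ℂ} (hq : ‖q‖ < 1) (x : ℂ) :
    qPochInf q x = (1 - x) * qPochInf q (x * q) := by
  have h2 : Multipliable fun j : ℕ => 1 - x * q ^ (j + 1) := by
    simpa [pow_succ', mul_assoc] using multipliable_qPochInf hq (x * q)
  have := tprod_eq_zero_mul' (f := fun j : ℕ => 1 - x * q ^ j) h2
  rw [qPochInf, this, qPochInf]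
  simp only [pow_zero, mul_one, pow_succ', mul_assoc]

lemma qPochInf_eq_qPoch_mul {q : ℂ} (hq : ‖q‖ < 1) (x : ℂ) (n : ℕ) :
    qPochInf q x = qPoch q x n * qPochInf q (x * q ^ n) := by
  induction n with
  | zero => simp [qPoch]
  | succ n ih =>
    rw [ih, qPochInf_eq_mul hq (x * q ^ n)]
    simp only [qPoch, Finset.prod_range_succ, pow_succ]
    ring_nf

lemma qPochInf_eq_zero {q x : ℂ} (hq : ‖q‖ < 1) (hx : ¬ Reg q x) : qPochInf q x = 0 := by
  obtain ⟨k, hk⟩ : ∃ k : ℕ, x * q ^ k = 1 := by simpa [Reg] using hx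
  rw [qPochInf_eq_qPoch_mul hq x (k + 1), qPoch, Finset.prod_range_succ, hk]
  simp

lemma differentiable_qPochInf {q : ℂ} (hq : ‖q‖ < 1) : Differentiable ℂ (qPochInf q) := by
  intro x
  have key : DifferentiableOn ℂ (qPochInf q) (Metric.ball 0 (‖x‖ + 1)) := by
    have h : MultipliableLocallyUniformlyOn (fun (j : ℕ) (y : ℂ) => 1 + -(y * q ^ j))
        (Metric.ball 0 (‖x‖ + 1)) := by
      refine Summable.multipliableLocallyUniformlyOn_nat_one_add (R := ℂ)
        (u := fun j => (‖x‖ + 1) * ‖q‖ ^ j) Metric.isOpen_ball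
        ((summable_geometric_of_lt_one (norm_nonneg q) hq).mul_left _) ?_ ?_
      · refine .of_forall fun n y hy => ?_
        rw [norm_neg, norm_mul, norm_pow]
        gcongr
        simpa using (mem_ball_zero_iff.1 hy).le
      · intro n; fun_prop
    have h2 := h.hasProdLocallyUniformlyOn.differentiableOn
      (.of_forall fun s => by
        simpa [Finset.prod_fn] using DifferentiableOn.finsetProd (fun _ _ => by fun_prop))
      Metric.isOpen_ball
    refine h2.congr fun y _ => ?_
    simp [qPochInf, sub_eq_add_neg]
  exact key.differentiableAt (Metric.isOpen_ball.mem_nhds (by simp))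

lemma reg_iff_qPochInf_ne_zero {q x : ℂ} (hq : ‖q‖ < 1) : Reg q x ↔ qPochInf q x ≠ 0 :=
  ⟨qPochInf_ne_zero hq, fun h => by by_contra h'; exact h (qPochInf_eq_zero hq h')⟩

/-- The infinitely many conditions are packed into the nonvanishing of one entire function. -/
lemma isOpen_setOf_reg {q : ℂ} (hq : ‖q‖ < 1) : IsOpen {x | Reg q x} := by
  have : {x | Reg q x} = {x | qPochInf q x ≠ 0} := by
    ext x; exact reg_iff_qPochInf_ne_zero hq
  rw [this]
  exact isOpen_ne_fun (differentiable_qPochInf hq).continuous continuous_const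

lemma isOpen_setOf_reg_mul {q : ℂ} (hq : ‖q‖ < 1) (u : ℂ) : IsOpen {s | Reg q (u * s)} :=
  (isOpen_setOf_reg hq).preimage (continuous_const.mul continuous_id)

/-- Each `k` excludes at most one `s`. A countable complement makes a domain both dense and
connected, as the extension principles below require. -/
lemma countable_compl_reg_mul (q u : ℂ) : {s | Reg q (u * s)}ᶜ.Countable := by
  have : {s | Reg q (u * s)}ᶜ ⊆ ⋃ k : ℕ, {(u * q ^ k)⁻¹} := by
    intro s hs
    obtain ⟨k, hk⟩ : ∃ k : ℕ, u * s * q ^ k = 1 := by simpa [Reg] using hs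
    refine Set.mem_iUnion.2 ⟨k, ?_⟩
    rw [Set.mem_singleton_iff]
    exact eq_inv_of_mul_eq_one_left (by linear_combination hk)
  exact (Set.countable_iUnion fun k => Set.countable_singleton _).mono this

/-- Two functions that are continuous on an open set and agree there off a countable set agree. -/
lemma eqOn_of_countable {f g : ℂ → ℂ} {U S : Set ℂ} (hU : IsOpen U) (hS : Sᶜ.Countable)
    (hf : ContinuousOn f U) (hg : ContinuousOn g U) (h : ∀ s ∈ U, s ∈ S → f s = g s) :
    Set.EqOn f g U := by
  have hd : Dense S := by simpa using hS.dense_compl ℂ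
  exact Set.EqOn.of_subset_closure (s := U ∩ S) (fun s hs => h s hs.1 hs.2) hf hg
    Set.inter_subset_left (hd.open_subset_closure_inter hU)

/-- The identity theorem on an open set with countable complement, for functions that agree at the
points `q^n` for large `n`. -/
lemma eqOn_of_eq_pow {q : ℂ} (hq0 : q ≠ 0) (hq : ‖q‖ < 1) {f g : ℂ → ℂ} {U : Set ℂ} (hU : IsOpen U)
    (hc : Uᶜ.Countable) (h0 : (0 : ℂ) ∈ U) (hf : DifferentiableOn ℂ f U)
    (hg : DifferentiableOn ℂ g U) (h : ∀ᶠ n : ℕ in atTop, f (q ^ n) = g (q ^ n)) :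
    Set.EqOn f g U := by
  have hpre : IsPreconnected U := by
    have := (hc.isConnected_compl_of_one_lt_rank (E := ℂ)
      (by simp only [Complex.rank_real_complex, Nat.one_lt_ofNat])).isPreconnected
    simpa using this
  refine AnalyticOnNhd.eqOn_of_preconnected_of_frequently_eq (hf.analyticOnNhd hU)
    (hg.analyticOnNhd hU) hpre h0 ?_
  have ht : Tendsto (fun n : ℕ => q ^ n) atTop (𝓝[≠] 0) :=
    tendsto_nhdsWithin_iff.2 ⟨tendsto_pow_atTop_nhds_zero_of_norm_lt_one hq,
      .of_forall fun n => pow_ne_zero n hq0⟩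
  exact ht.frequently h.frequently

/-! ### Analytic continuation by the q-difference equation. -/

/-- The sequence with `A 0 = 1` and `A (n + 1) / A n = P(q^n) / Q(q^{n+1})`. -/
noncomputable def ratioTerm (q : ℂ) (P Q : Polynomial ℂ) (n : ℕ) : ℂ :=
  ∏ j ∈ Finset.range n, P.eval (q ^ j) / Q.eval (q ^ (j + 1))

/-- The conditions under which `∑ A n x^n`, with `A n = ratioTerm q P Q n`, has an analytic
continuation to `x = 1` by means of its `q`-difference equation. -/
structure GoodRatio (q : ℂ) (m : ℕ) (P Q : Polynomial ℂ) : Prop where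
  degP : P.natDegree ≤ m
  degQ : Q.natDegree ≤ m
  -- Q(0) = 1 makes 1 - P(0)q^j the coefficient of the lowest level in the q-difference equation;
  -- Q(1) = 0 removes the boundary term at n = 0.
  coeff_zero : Q.coeff 0 = 1
  eval_one : Q.eval 1 = 0
  eval_ne : ∀ n : ℕ, Q.eval (q ^ (n + 1)) ≠ 0
  reg : Reg q (P.coeff 0)

/-- The sum `∑ A n q^{jn}`. -/
noncomputable def levelSum (q : ℂ) (P Q : Polynomial ℂ) (j : ℕ) : ℂ :=
  ∑' n, ratioTerm q P Q n * q ^ (j * n)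

/-- The continuation of `levelSum` by `N` applications of the `q`-difference equation. -/
noncomputable def contLevel (q : ℂ) (m : ℕ) (P Q : Polynomial ℂ) : ℕ → ℕ → ℂ
  | 0, j => levelSum q P Q j
  | N + 1, j =>
    (∑ i ∈ Finset.range m, (q ^ j * P.coeff (i + 1) - Q.coeff (i + 1)) *
      contLevel q m P Q N (j + i + 1)) / (1 - P.coeff 0 * q ^ j)

open Classical in
/-- The value at `1` of the analytic continuation of `x ↦ ∑ A n x^n`. -/
noncomputable def contVal (q : ℂ) (m : ℕ) (P Q : Polynomial ℂ) : ℂ :=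
  -- For ‖q‖ < 1 the default 0 is never reached, and by `GoodRatio.contLevel_succ` any admissible
  -- depth gives the same value.
  if H : ∃ N : ℕ, ‖P.coeff 0 * q ^ N‖ < 1 then contLevel q m P Q (Nat.find H) 0 else 0

lemma eventually_norm_mul_pow_lt_one {q : ℂ} (hq : ‖q‖ < 1) (x : ℂ) :
    ∀ᶠ N : ℕ in atTop, ‖x * q ^ N‖ < 1 := by
  have : Tendsto (fun N : ℕ => ‖x * q ^ N‖) atTop (𝓝 0) := by
    simpa using ((tendsto_pow_atTop_nhds_zero_of_norm_lt_one hq).const_mul x).norm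
  exact this.eventually_lt_const one_pos

lemma norm_mul_pow_lt_one {q x : ℂ} (hq : ‖q‖ < 1) {j k : ℕ} (hjk : j ≤ k)
    (h : ‖x * q ^ j‖ < 1) : ‖x * q ^ k‖ < 1 := by
  refine lt_of_le_of_lt ?_ h
  rw [norm_mul, norm_mul, norm_pow, norm_pow]
  exact mul_le_mul_of_nonneg_left (pow_le_pow_of_le_one (norm_nonneg _) hq.le hjk) (norm_nonneg _)

lemma ratioTerm_succ (q : ℂ) (P Q : Polynomial ℂ) (n : ℕ) :
    ratioTerm q P Q (n + 1) = ratioTerm q P Q n * (P.eval (q ^ n) / Q.eval (q ^ (n + 1))) := by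
  rw [ratioTerm, Finset.prod_range_succ, ratioTerm]

/-- Near a parameter with `‖ζ q^j‖ < 1` the ratio of consecutive terms is uniformly less than
some `ρ < 1` from some index on. -/
lemma eventually_ratio_le {q : ℂ} (hq : ‖q‖ < 1) {m : ℕ} {P Q : ℂ → Polynomial ℂ} {U : Set ℂ}
    (hU : IsOpen U) (hP : ∀ i, DifferentiableOn ℂ (fun t => (P t).coeff i) U)
    (hQ : ∀ i, DifferentiableOn ℂ (fun t => (Q t).coeff i) U)
    (hg : ∀ t ∈ U, GoodRatio q m (P t) (Q t)) {t₀ : ℂ} (ht₀ : t₀ ∈ U) {j : ℕ}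
    (hj : ‖(P t₀).coeff 0 * q ^ j‖ < 1) :
    ∃ ρ : ℝ, ρ < 1 ∧ 0 ≤ ρ ∧ ∃ n₀ : ℕ, ∀ᶠ t in 𝓝 t₀, ∀ n ≥ n₀,
      ‖(P t).eval (q ^ n) / (Q t).eval (q ^ (n + 1)) * q ^ j‖ ≤ ρ := by
  obtain ⟨ρ, hρ1, hρ2⟩ := exists_between hj
  refine ⟨ρ, hρ2, (norm_nonneg _).trans hρ1.le, ?_⟩
  have hUn : U ∈ 𝓝 t₀ := hU.mem_nhds ht₀
  -- Continuity is needed jointly in the parameter and in X = q^n at (t₀, 0): there the ratio equals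
  -- P(0)q^j, of norm below ρ, so the bound holds on a product neighbourhood.
  have hcont : ∀ R : ℂ → Polynomial ℂ, (∀ i, DifferentiableOn ℂ (fun t => (R t).coeff i) U) →
      ContinuousAt (fun p : ℂ × ℂ => ∑ i ∈ Finset.range (m + 1), (R p.1).coeff i * p.2 ^ i)
        (t₀, 0) := by
    intro R hR
    refine tendsto_finsetSum _ fun i _ => ?_
    refine ContinuousAt.mul ?_ (by fun_prop)
    exact ContinuousAt.comp (f := Prod.fst) (g := fun t => (R t).coeff i)
      ((hR i).continuousOn.continuousAt hUn) continuousAt_fst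
  have h1 : ContinuousAt (fun p : ℂ × ℂ =>
      (∑ i ∈ Finset.range (m + 1), (P p.1).coeff i * p.2 ^ i) /
        (∑ i ∈ Finset.range (m + 1), (Q p.1).coeff i * (q * p.2) ^ i) * q ^ j) (t₀, 0) := by
    refine ((hcont P hP).div ?_ ?_).mul continuousAt_const
    · have h2 : ContinuousAt (fun p : ℂ × ℂ => (p.1, q * p.2)) (t₀, 0) := by fun_prop
      have h3 := hcont Q hQ
      exact ContinuousAt.comp (f := fun p : ℂ × ℂ => (p.1, q * p.2)) (x := (t₀, (0 : ℂ)))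
        (g := fun p : ℂ × ℂ => ∑ i ∈ Finset.range (m + 1), (Q p.1).coeff i * p.2 ^ i)
        (by simpa using h3) h2
    · simp [Finset.sum_range_succ', (hg t₀ ht₀).coeff_zero]
  have h2 := h1.norm.eventually_lt (continuousAt_const (y := ρ)) (by
    simpa [Finset.sum_range_succ', (hg t₀ ht₀).coeff_zero] using hρ1)
  rw [nhds_prod_eq] at h2
  obtain ⟨pa, hpa, pb, hpb, hab⟩ := eventually_prod_iff.1 h2
  obtain ⟨n₀, hn₀⟩ := eventually_atTop.1
    ((tendsto_pow_atTop_nhds_zero_of_norm_lt_one hq).eventually hpb)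
  refine ⟨n₀, ?_⟩
  filter_upwards [hpa, hUn] with t ht htU n hn
  have h3 := hab ht (hn₀ n hn)
  rw [Polynomial.eval_eq_sum_range' (n := m + 1) (Nat.lt_succ_of_le (hg t htU).degP),
    Polynomial.eval_eq_sum_range' (n := m + 1) (Nat.lt_succ_of_le (hg t htU).degQ), pow_succ']
  exact h3.le

lemma ratioTerm_bound {q : ℂ} {P Q : Polynomial ℂ} {j n₀ : ℕ} {ρ : ℝ} (hρ0 : 0 ≤ ρ)
    (h : ∀ n ≥ n₀, ‖P.eval (q ^ n) / Q.eval (q ^ (n + 1)) * q ^ j‖ ≤ ρ) (n : ℕ) :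
    ‖ratioTerm q P Q (n + n₀) * q ^ (j * (n + n₀))‖ ≤
      ‖ratioTerm q P Q n₀ * q ^ (j * n₀)‖ * ρ ^ n := by
  induction n with
  | zero => simp
  | succ n ih =>
    have : ratioTerm q P Q (n + 1 + n₀) * q ^ (j * (n + 1 + n₀)) =
        (ratioTerm q P Q (n + n₀) * q ^ (j * (n + n₀))) *
          (P.eval (q ^ (n + n₀)) / Q.eval (q ^ (n + n₀ + 1)) * q ^ j) := by
      rw [show n + 1 + n₀ = n + n₀ + 1 by ring, ratioTerm_succ, mul_add, pow_add, mul_one]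
      ring
    rw [this, norm_mul, pow_succ ρ, ← mul_assoc]
    exact mul_le_mul ih (h _ (by omega)) (norm_nonneg _) (by positivity)

lemma GoodRatio.summable {q : ℂ} (hq : ‖q‖ < 1) {m : ℕ} {P Q : Polynomial ℂ}
    (hg : GoodRatio q m P Q) {j : ℕ} (hj : ‖P.coeff 0 * q ^ j‖ < 1) :
    Summable fun n => ratioTerm q P Q n * q ^ (j * n) := by
  obtain ⟨ρ, hρ1, hρ0, n₀, h⟩ := eventually_ratio_le (U := Set.univ) (P := fun _ => P)
    (Q := fun _ => Q) hq isOpen_univ (fun i => by fun_prop) (fun i => by fun_prop)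
    (fun _ _ => hg) (Set.mem_univ 0) hj
  rw [← summable_nat_add_iff n₀]
  exact Summable.of_norm_bounded ((summable_geometric_of_lt_one hρ0 hρ1).mul_left _)
    (ratioTerm_bound hρ0 h.self_of_nhds)

/-- The sum splits into finitely many holomorphic terms and a tail dominated near `t₀` by one
geometric series, independent of the parameter. -/
lemma differentiableAt_levelSum {q : ℂ} (hq : ‖q‖ < 1) {m : ℕ} {P Q : ℂ → Polynomial ℂ}
    {U : Set ℂ} (hU : IsOpen U) (hP : ∀ i, DifferentiableOn ℂ (fun t => (P t).coeff i) U)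
    (hQ : ∀ i, DifferentiableOn ℂ (fun t => (Q t).coeff i) U)
    (hg : ∀ t ∈ U, GoodRatio q m (P t) (Q t)) {t₀ : ℂ} (ht₀ : t₀ ∈ U) {j : ℕ}
    (hj : ‖(P t₀).coeff 0 * q ^ j‖ < 1) :
    DifferentiableAt ℂ (fun t => levelSum q (P t) (Q t) j) t₀ := by
  obtain ⟨ρ, hρ1, hρ0, n₀, h⟩ := eventually_ratio_le hq hU hP hQ hg ht₀ hj
  have hev : ∀ R : ℂ → Polynomial ℂ, (∀ i, DifferentiableOn ℂ (fun t => (R t).coeff i) U) →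
      (∀ t ∈ U, (R t).natDegree ≤ m) → ∀ x, DifferentiableOn ℂ (fun t => (R t).eval x) U := by
    intro R hR hd x
    have : DifferentiableOn ℂ
        (fun t => ∑ i ∈ Finset.range (m + 1), (R t).coeff i * x ^ i) U :=
      DifferentiableOn.fun_sum fun i _ => (hR i).mul_const _
    exact this.congr fun t ht =>
      Polynomial.eval_eq_sum_range' (Nat.lt_succ_of_le (hd t ht)) x
  have hterm : ∀ n, DifferentiableOn ℂ (fun t => ratioTerm q (P t) (Q t) n * q ^ (j * n)) U := by
    intro n
    refine DifferentiableOn.mul_const ?_ _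
    refine DifferentiableOn.fun_finsetProd fun i _ => ?_
    exact (hev P hP (fun t ht => (hg t ht).degP) _).fun_div
      (hev Q hQ (fun t ht => (hg t ht).degQ) _) fun t ht => (hg t ht).eval_ne i
  set K : ℝ := ‖ratioTerm q (P t₀) (Q t₀) n₀ * q ^ (j * n₀)‖ + 1
  have hK : ∀ᶠ t in 𝓝 t₀, ‖ratioTerm q (P t) (Q t) n₀ * q ^ (j * n₀)‖ < K :=
    (((hterm n₀).continuousOn.continuousAt (hU.mem_nhds ht₀)).norm).eventually_lt
      continuousAt_const (by simp [K])
  have hz : ∀ᶠ t in 𝓝 t₀, ‖(P t).coeff 0 * q ^ j‖ < 1 :=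
    ((((hP 0).continuousOn.continuousAt (hU.mem_nhds ht₀)).mul continuousAt_const).norm).eventually_lt
      continuousAt_const hj
  obtain ⟨V, hV, hVo, htV⟩ := eventually_nhds_iff.1
    ((h.and hK).and (hz.and (hU.mem_nhds ht₀)))
  have htail : DifferentiableOn ℂ
      (fun t => ∑' n, ratioTerm q (P t) (Q t) (n + n₀) * q ^ (j * (n + n₀))) V := by
    refine Complex.differentiableOn_tsum_of_summable_norm (u := fun n => K * ρ ^ n)
      ((summable_geometric_of_lt_one hρ0 hρ1).mul_left _)
      (fun n => (hterm (n + n₀)).mono fun t ht => (hV t ht).2.2) hVo fun n t ht => ?_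
    refine (ratioTerm_bound hρ0 (hV t ht).1.1 n).trans ?_
    gcongr
    exact (hV t ht).1.2.le
  have hhead : DifferentiableOn ℂ
      (fun t => ∑ n ∈ Finset.range n₀, ratioTerm q (P t) (Q t) n * q ^ (j * n)) V :=
    DifferentiableOn.fun_sum fun n _ => (hterm n).mono fun t ht => (hV t ht).2.2
  refine ((hhead.add htail).congr fun t ht => ?_).differentiableAt (hVo.mem_nhds htV)
  exact (((hg t (hV t ht).2.2).summable hq (hV t ht).2.1).sum_add_tsum_nat_add n₀).symm

/-- The `q`-difference equation. -/
lemma GoodRatio.levelSum_eq {q : ℂ} (hq : ‖q‖ < 1) {m : ℕ} {P Q : Polynomial ℂ}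
    (hg : GoodRatio q m P Q) {j : ℕ} (hj : ‖P.coeff 0 * q ^ j‖ < 1) :
    (1 - P.coeff 0 * q ^ j) * levelSum q P Q j =
      ∑ i ∈ Finset.range m, (q ^ j * P.coeff (i + 1) - Q.coeff (i + 1)) *
        levelSum q P Q (j + i + 1) := by
  have hs : ∀ i, Summable fun n => ratioTerm q P Q n * q ^ ((j + i) * n) := fun i =>
    hg.summable hq (norm_mul_pow_lt_one hq (Nat.le_add_right j i) hj)
  -- Expanding R(q^n) in powers of q^n turns the weighted sum into a combination of the levels j +
  -- i.
  have hexp : ∀ R : Polynomial ℂ, R.natDegree ≤ m →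
      HasSum (fun n => ratioTerm q P Q n * R.eval (q ^ n) * q ^ (j * n))
        (∑ i ∈ Finset.range (m + 1), R.coeff i * levelSum q P Q (j + i)) := by
    intro R hR
    have := hasSum_sum (s := Finset.range (m + 1)) fun i _ => ((hs i).hasSum.mul_left (R.coeff i))
    refine Eq.mp (congrArg (HasSum · _) (funext fun n => ?_)) this
    rw [Polynomial.eval_eq_sum_range' (Nat.lt_succ_of_le hR), Finset.mul_sum, Finset.sum_mul]
    refine Finset.sum_congr rfl fun i _ => ?_
    rw [add_mul, pow_add, mul_comm i n, pow_mul q n i]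
    ring
  have hQ := hexp Q hg.degQ
  have hP := (hexp P hg.degP).mul_left (q ^ j)
  -- The dropped term n = 0 has weight Q(1) = 0. After the shift, A(n+1)Q(q^{n+1}) = A(n)P(q^n)
  -- identifies the two sums.
  rw [← hasSum_nat_add_iff' 1] at hQ
  have h0 : ∀ n, ratioTerm q P Q (n + 1) * Q.eval (q ^ (n + 1)) * q ^ (j * (n + 1)) =
      q ^ j * (ratioTerm q P Q n * P.eval (q ^ n) * q ^ (j * n)) := by
    intro n
    have := hg.eval_ne n
    rw [ratioTerm_succ, show q ^ (j * (n + 1)) = q ^ (j * n) * q ^ j by rw [mul_add_one, pow_add]]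
    generalize Q.eval (q ^ (n + 1)) = y at this
    field_simp
  simp only [h0] at hQ
  have h1 := hQ.unique hP
  simp only [Finset.range_one, Finset.sum_singleton, pow_zero, hg.eval_one, mul_zero, zero_mul,
    sub_zero] at h1
  rw [Finset.sum_range_succ', Finset.sum_range_succ', hg.coeff_zero] at h1
  simp only [sub_mul, Finset.sum_sub_distrib, mul_assoc, add_zero, one_mul, ← Finset.mul_sum] at h1 ⊢
  simp only [add_assoc] at h1 ⊢
  linear_combination h1

lemma GoodRatio.one_sub_ne_zero {q : ℂ} {m : ℕ} {P Q : Polynomial ℂ} (hg : GoodRatio q m P Q)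
    (j : ℕ) : 1 - P.coeff 0 * q ^ j ≠ 0 := sub_ne_zero.2 (hg.reg j).symm

/-- The recursion replays the q-difference equation, so it changes nothing where the series already
converges. -/
lemma GoodRatio.contLevel_eq_levelSum {q : ℂ} (hq : ‖q‖ < 1) {m : ℕ} {P Q : Polynomial ℂ}
    (hg : GoodRatio q m P Q) (N : ℕ) {j : ℕ} (hj : ‖P.coeff 0 * q ^ j‖ < 1) :
    contLevel q m P Q N j = levelSum q P Q j := by
  induction N generalizing j with
  | zero => rfl
  | succ N ih =>
    rw [contLevel, div_eq_iff (hg.one_sub_ne_zero j), mul_comm, hg.levelSum_eq hq hj]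
    refine Finset.sum_congr rfl fun i _ => ?_
    rw [ih (norm_mul_pow_lt_one hq (by omega) hj)]

/-- Once the levels from j + N on converge, one further unfolding has no effect; this makes the
depth immaterial. -/
lemma GoodRatio.contLevel_succ {q : ℂ} (hq : ‖q‖ < 1) {m : ℕ} {P Q : Polynomial ℂ}
    (hg : GoodRatio q m P Q) {N j : ℕ} (hj : ‖P.coeff 0 * q ^ (j + N)‖ < 1) :
    contLevel q m P Q (N + 1) j = contLevel q m P Q N j := by
  induction N generalizing j with
  | zero => exact hg.contLevel_eq_levelSum hq 1 hj
  | succ N ih =>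
    rw [contLevel, contLevel]
    refine congrArg (· / _) (Finset.sum_congr rfl fun i _ => ?_)
    rw [ih (norm_mul_pow_lt_one hq (by omega) hj)]

lemma GoodRatio.contVal_eq {q : ℂ} (hq : ‖q‖ < 1) {m : ℕ} {P Q : Polynomial ℂ}
    (hg : GoodRatio q m P Q) {N : ℕ} (hN : ‖P.coeff 0 * q ^ N‖ < 1) :
    contVal q m P Q = contLevel q m P Q N 0 := by
  classical
  have H : ∃ N : ℕ, ‖P.coeff 0 * q ^ N‖ < 1 := ⟨N, hN⟩
  rw [contVal, dif_pos H]
  have hle : Nat.find H ≤ N := Nat.find_min' H hN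
  induction N, hle using Nat.le_induction with
  | base => convert rfl
  | succ n hn ih =>
    have hn' := norm_mul_pow_lt_one hq hn (Nat.find_spec H)
    rw [ih hn', hg.contLevel_succ hq (by simpa using hn')]

lemma GoodRatio.contVal_eq_tsum {q : ℂ} (hq : ‖q‖ < 1) {m : ℕ} {P Q : Polynomial ℂ}
    (hg : GoodRatio q m P Q) (h : ‖P.coeff 0‖ < 1) :
    contVal q m P Q = ∑' n, ratioTerm q P Q n := by
  rw [hg.contVal_eq hq (N := 0) (by simpa using h)]
  simp [contLevel, levelSum]

lemma differentiableAt_contLevel {q : ℂ} (hq : ‖q‖ < 1) {m : ℕ} {P Q : ℂ → Polynomial ℂ}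
    {U : Set ℂ} (hU : IsOpen U) (hP : ∀ i, DifferentiableOn ℂ (fun t => (P t).coeff i) U)
    (hQ : ∀ i, DifferentiableOn ℂ (fun t => (Q t).coeff i) U)
    (hg : ∀ t ∈ U, GoodRatio q m (P t) (Q t)) {t₀ : ℂ} (ht₀ : t₀ ∈ U) {N j : ℕ}
    (hj : ‖(P t₀).coeff 0 * q ^ (j + N)‖ < 1) :
    DifferentiableAt ℂ (fun t => contLevel q m (P t) (Q t) N j) t₀ := by
  have hUn := hU.mem_nhds ht₀
  induction N generalizing j with
  | zero => exact differentiableAt_levelSum hq hU hP hQ hg ht₀ hj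
  | succ N ih =>
    simp only [contLevel]
    refine DifferentiableAt.fun_div (DifferentiableAt.fun_sum fun i _ => ?_) ?_
      ((hg t₀ ht₀).one_sub_ne_zero j)
    · exact ((((hP _).differentiableAt hUn).const_mul _).sub ((hQ _).differentiableAt hUn)).mul
        (ih (norm_mul_pow_lt_one hq (by omega) hj))
    · exact (((hP 0).differentiableAt hUn).mul_const _).const_sub _

/-- The continuation depends holomorphically on parameters. -/
theorem differentiableOn_contVal {q : ℂ} (hq : ‖q‖ < 1) {m : ℕ} {P Q : ℂ → Polynomial ℂ}
    {U : Set ℂ} (hU : IsOpen U) (hP : ∀ i, DifferentiableOn ℂ (fun t => (P t).coeff i) U)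
    (hQ : ∀ i, DifferentiableOn ℂ (fun t => (Q t).coeff i) U)
    (hg : ∀ t ∈ U, GoodRatio q m (P t) (Q t)) :
    DifferentiableOn ℂ (fun t => contVal q m (P t) (Q t)) U := by
  intro t₀ ht₀
  obtain ⟨N, hN⟩ := (eventually_norm_mul_pow_lt_one hq ((P t₀).coeff 0)).exists
  have hz : ∀ᶠ t in 𝓝 t₀, ‖(P t).coeff 0 * q ^ N‖ < 1 :=
    ((((hP 0).continuousOn.continuousAt (hU.mem_nhds ht₀)).mul
      continuousAt_const).norm).eventually_lt continuousAt_const hN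
  refine DifferentiableAt.differentiableWithinAt ?_
  -- A single depth N serves a whole neighbourhood, so the least depth chosen in `contVal`, which
  -- varies with the parameter, does no harm.
  refine (differentiableAt_contLevel (N := N) (j := 0) hq hU hP hQ hg ht₀
    (by simpa using hN)).congr_of_eventuallyEq ?_
  filter_upwards [hz, hU.mem_nhds ht₀] with t ht htU
  exact (hg t htU).contVal_eq hq ht

/-- Identification of `phi` with the continuation built from the `q`-difference equation. -/
theorem phi_eq_contVal {q : ℂ} (hq : ‖q‖ < 1) {m : ℕ} {as bs : List ℂ} {P : ℂ → Polynomial ℂ}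
    {Q : Polynomial ℂ} (hP : ∀ i, Differentiable ℂ (fun t => (P t).coeff i))
    (hP0 : ∀ t, (P t).coeff 0 = t) (hg : ∀ t, Reg q t → GoodRatio q m (P t) Q)
    (hA : ∀ t n, phiCoeff q as bs n * t ^ n = ratioTerm q (P t) Q n) {z : ℂ} (hz : Reg q z) :
    phi q as bs z = contVal q m (P z) Q := by
  have hU := isOpen_setOf_reg hq
  have hreg : ∀ t : ℂ, ‖t‖ < 1 → Reg q t := fun t ht k h => by
    have := norm_mul_pow_lt_one hq (Nat.zero_le k) (x := t) (by simpa using ht)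
    rw [h] at this
    simp at this
  have hc : IsPhiContinuation q as bs (fun t => contVal q m (P t) Q) := by
    refine ⟨differentiableOn_contVal hq hU (fun i => (hP i).differentiableOn)
      (fun i => differentiableOn_const _) hg, fun t ht => ?_⟩
    have h1 := hg t (hreg t ht)
    beta_reduce
    rw [h1.contVal_eq_tsum hq (by rwa [hP0])]
    simp only [hA]
    simpa using (h1.summable hq (j := 0) (by simpa [hP0] using ht)).hasSum
  have H : ∃ g : ℂ → ℂ, IsPhiContinuation q as bs g := ⟨_, hc⟩
  rw [phi, dif_pos H]
  have hs := H.choose_spec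
  have hpre : IsPreconnected {t | Reg q t} := by
    have := ((countable_compl_reg_mul q 1).isConnected_compl_of_one_lt_rank (E := ℂ)
      (by simp only [Complex.rank_real_complex, Nat.one_lt_ofNat])).isPreconnected
    simpa using this
  -- `phi` is an arbitrary choice among continuations, but its values on the connected regular set
  -- are forced by those on the unit disc.
  refine AnalyticOnNhd.eqOn_of_preconnected_of_eventuallyEq (hs.1.analyticOnNhd hU)
    (hc.1.analyticOnNhd hU) hpre (reg_zero q) ?_ hz
  filter_upwards [Metric.ball_mem_nhds (0 : ℂ) one_pos] with t ht
  rw [mem_ball_zero_iff] at ht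
  exact (hs.2 t ht).unique (hc.2 t ht)

/-! ### Very-well-poised series as continued sums. -/

/-- Numerator of the term ratio of a very-well-poised series. -/
noncomputable def vwpNum (q z y a b c d e : ℂ) : Polynomial ℂ :=
  (.C z - .C y * .X) * (.C 1 - .C a * .X) * (.C 1 - .C (a * q ^ 2) * .X ^ 2) *
    (.C 1 - .C b * .X) * (.C 1 - .C c * .X) * (.C 1 - .C d * .X) * (.C 1 - .C e * .X)

/-- Denominator of the term ratio of a very-well-poised series. -/
noncomputable def vwpDen (q a g₁ g₂ g₃ g₄ g₅ : ℂ) : Polynomial ℂ :=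
  (.C 1 - .C 1 * .X) * (.C 1 - .C (a / q ^ 2) * .X ^ 2) * (.C 1 - .C (g₁ / q) * .X) *
    (.C 1 - .C (g₂ / q) * .X) * (.C 1 - .C (g₃ / q) * .X) * (.C 1 - .C (g₄ / q) * .X) *
    (.C 1 - .C (g₅ / q) * .X)

/-- The continuation of the series with term ratio
`(z - y X)(1 - a X)(1 - a q² X²)(1 - b X)⋯(1 - e X) / ((1 - q X)(1 - a X²)(1 - g₁ X)⋯(1 - g₅ X))`,
`X = q^n`. -/
noncomputable def vwpSum (q z y a b c d e g₁ g₂ g₃ g₄ g₅ : ℂ) : ℂ :=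
  contVal q 8 (vwpNum q z y a b c d e) (vwpDen q a g₁ g₂ g₃ g₄ g₅)

/-- The term ratio of the series behind `vwpSum`. -/
noncomputable def vwpRatio (q z y a b c d e g₁ g₂ g₃ g₄ g₅ X : ℂ) : ℂ :=
  (z - y * X) * (1 - a * X) * (1 - a * q ^ 2 * X ^ 2) * (1 - b * X) * (1 - c * X) * (1 - d * X) *
      (1 - e * X) /
    ((1 - q * X) * (1 - a * X ^ 2) * (1 - g₁ * X) * (1 - g₂ * X) * (1 - g₃ * X) * (1 - g₄ * X) *
      (1 - g₅ * X))

/-- The parameters are nonsingular for `vwpSum`. -/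
structure VwpReg (q z a g₁ g₂ g₃ g₄ g₅ : ℂ) : Prop where
  arg : Reg q z
  base : Reg (q ^ 2) a
  low₁ : Reg q g₁
  low₂ : Reg q g₂
  low₃ : Reg q g₃
  low₄ : Reg q g₄
  low₅ : Reg q g₅

lemma eval_vwpNum (q z y a b c d e X : ℂ) : (vwpNum q z y a b c d e).eval X =
    (z - y * X) * (1 - a * X) * (1 - a * q ^ 2 * X ^ 2) * (1 - b * X) * (1 - c * X) *
      (1 - d * X) * (1 - e * X) := by
  simp [vwpNum]

lemma eval_vwpDen {q : ℂ} (hq0 : q ≠ 0) (a g₁ g₂ g₃ g₄ g₅ : ℂ) (n : ℕ) :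
    (vwpDen q a g₁ g₂ g₃ g₄ g₅).eval (q ^ (n + 1)) =
    (1 - q * q ^ n) * (1 - a * (q ^ n) ^ 2) * (1 - g₁ * q ^ n) * (1 - g₂ * q ^ n) *
      (1 - g₃ * q ^ n) * (1 - g₄ * q ^ n) * (1 - g₅ * q ^ n) := by
  have h1 : ∀ g : ℂ, g / q * q ^ (n + 1) = g * q ^ n := fun g => by rw [pow_succ q n]; field_simp
  have h2 : a / q ^ 2 * (q ^ (n + 1)) ^ 2 = a * (q ^ n) ^ 2 := by rw [pow_succ q n]; field_simp
  simp only [vwpDen, Polynomial.eval_mul, Polynomial.eval_sub, Polynomial.eval_C,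
    Polynomial.eval_pow, Polynomial.eval_X, h1, h2]
  rw [pow_succ']; ring

lemma ratioTerm_vwp {q : ℂ} (hq0 : q ≠ 0) (z y a b c d e g₁ g₂ g₃ g₄ g₅ : ℂ) (n : ℕ) :
    ratioTerm q (vwpNum q z y a b c d e) (vwpDen q a g₁ g₂ g₃ g₄ g₅) n =
      ∏ j ∈ Finset.range n, vwpRatio q z y a b c d e g₁ g₂ g₃ g₄ g₅ (q ^ j) := by
  simp only [ratioTerm, eval_vwpNum, eval_vwpDen hq0, vwpRatio]

lemma reg_self {q : ℂ} (hq : ‖q‖ < 1) : Reg q q := fun k h => by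
  have h1 : ‖q * q ^ k‖ < 1 := by
    rw [← pow_succ', norm_pow]; exact pow_lt_one₀ (norm_nonneg _) hq (Nat.succ_ne_zero _)
  rw [h] at h1
  simp at h1

lemma VwpReg.good {q : ℂ} (hq0 : q ≠ 0) (hq : ‖q‖ < 1) {z a g₁ g₂ g₃ g₄ g₅ : ℂ}
    (h : VwpReg q z a g₁ g₂ g₃ g₄ g₅) (y b c d e : ℂ) :
    GoodRatio q 8 (vwpNum q z y a b c d e) (vwpDen q a g₁ g₂ g₃ g₄ g₅) where
  degP := by unfold vwpNum; compute_degree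
  degQ := by unfold vwpDen; compute_degree
  coeff_zero := by simp [vwpDen, Polynomial.mul_coeff_zero]
  eval_one := by simp [vwpDen]
  eval_ne n := by
    rw [eval_vwpDen hq0]
    have hs : ∀ {g}, Reg q g → 1 - g * q ^ n ≠ 0 := fun hg => sub_ne_zero.2 (hg n).symm
    have hb : 1 - a * (q ^ n) ^ 2 ≠ 0 := sub_ne_zero.2 (by
      have := (h.base n).symm; rwa [← pow_mul, mul_comm 2 n, pow_mul] at this)
    exact mul_ne_zero (mul_ne_zero (mul_ne_zero (mul_ne_zero (mul_ne_zero (mul_ne_zero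
      (hs (reg_self hq)) hb) (hs h.low₁)) (hs h.low₂)) (hs h.low₃)) (hs h.low₄)) (hs h.low₅)
  reg := by simpa [vwpNum, Polynomial.mul_coeff_zero] using h.arg

/-- All coefficients of a family of polynomials are holomorphic on `U`. -/
def CoeffDiff (U : Set ℂ) (R : ℂ → Polynomial ℂ) : Prop :=
  ∀ i, DifferentiableOn ℂ (fun t => (R t).coeff i) U

lemma CoeffDiff.mul {U : Set ℂ} {R S : ℂ → Polynomial ℂ} (hR : CoeffDiff U R)
    (hS : CoeffDiff U S) : CoeffDiff U fun t => R t * S t := fun i => by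
  simp only [Polynomial.coeff_mul]
  exact DifferentiableOn.fun_sum fun p _ => (hR _).mul (hS _)

lemma coeffDiff_linear {U : Set ℂ} {f g : ℂ → ℂ} (hf : DifferentiableOn ℂ f U)
    (hg : DifferentiableOn ℂ g U) (k : ℕ) :
    CoeffDiff U fun t => .C (f t) - .C (g t) * .X ^ k := fun i => by
  simp only [Polynomial.coeff_sub, Polynomial.coeff_C, Polynomial.coeff_C_mul,
    Polynomial.coeff_X_pow]
  split_ifs <;> fun_prop

lemma coeffDiff_linear_one {U : Set ℂ} {f g : ℂ → ℂ} (hf : DifferentiableOn ℂ f U)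
    (hg : DifferentiableOn ℂ g U) :
    CoeffDiff U fun t => .C (f t) - .C (g t) * .X := by
  simpa using coeffDiff_linear hf hg 1

lemma coeffDiff_vwpNum (q : ℂ) {U : Set ℂ} {z y a b c d e : ℂ → ℂ} (hz : DifferentiableOn ℂ z U)
    (hy : DifferentiableOn ℂ y U) (ha : DifferentiableOn ℂ a U) (hb : DifferentiableOn ℂ b U)
    (hc : DifferentiableOn ℂ c U) (hd : DifferentiableOn ℂ d U) (he : DifferentiableOn ℂ e U) :
    CoeffDiff U fun t => vwpNum q (z t) (y t) (a t) (b t) (c t) (d t) (e t) := by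
  have h1 := differentiableOn_const (s := U) (1 : ℂ) (𝕜 := ℂ) (E := ℂ)
  exact ((((((coeffDiff_linear_one hz hy).mul (coeffDiff_linear_one h1 ha)).mul
    (coeffDiff_linear h1 (ha.mul_const _) 2)).mul (coeffDiff_linear_one h1 hb)).mul
    (coeffDiff_linear_one h1 hc)).mul (coeffDiff_linear_one h1 hd)).mul
    (coeffDiff_linear_one h1 he)

lemma coeffDiff_vwpDen (q : ℂ) {U : Set ℂ} {a g₁ g₂ g₃ g₄ g₅ : ℂ → ℂ}
    (ha : DifferentiableOn ℂ a U) (h₁ : DifferentiableOn ℂ g₁ U) (h₂ : DifferentiableOn ℂ g₂ U)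
    (h₃ : DifferentiableOn ℂ g₃ U) (h₄ : DifferentiableOn ℂ g₄ U)
    (h₅ : DifferentiableOn ℂ g₅ U) :
    CoeffDiff U fun t => vwpDen q (a t) (g₁ t) (g₂ t) (g₃ t) (g₄ t) (g₅ t) := by
  have h1 := differentiableOn_const (s := U) (1 : ℂ) (𝕜 := ℂ) (E := ℂ)
  exact ((((((coeffDiff_linear_one h1 h1).mul (coeffDiff_linear h1 (ha.div_const _) 2)).mul
    (coeffDiff_linear_one h1 (h₁.div_const _))).mul (coeffDiff_linear_one h1 (h₂.div_const _))).mul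
    (coeffDiff_linear_one h1 (h₃.div_const _))).mul
    (coeffDiff_linear_one h1 (h₄.div_const _))).mul (coeffDiff_linear_one h1 (h₅.div_const _))

lemma differentiableOn_vwpSum {q : ℂ} (hq0 : q ≠ 0) (hq : ‖q‖ < 1) {U : Set ℂ} (hU : IsOpen U)
    {z y a b c d e g₁ g₂ g₃ g₄ g₅ : ℂ → ℂ} (hz : DifferentiableOn ℂ z U)
    (hy : DifferentiableOn ℂ y U) (ha : DifferentiableOn ℂ a U) (hb : DifferentiableOn ℂ b U)
    (hc : DifferentiableOn ℂ c U) (hd : DifferentiableOn ℂ d U) (he : DifferentiableOn ℂ e U)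
    (h₁ : DifferentiableOn ℂ g₁ U) (h₂ : DifferentiableOn ℂ g₂ U)
    (h₃ : DifferentiableOn ℂ g₃ U) (h₄ : DifferentiableOn ℂ g₄ U)
    (h₅ : DifferentiableOn ℂ g₅ U)
    (hr : ∀ t ∈ U, VwpReg q (z t) (a t) (g₁ t) (g₂ t) (g₃ t) (g₄ t) (g₅ t)) :
    DifferentiableOn ℂ (fun t => vwpSum q (z t) (y t) (a t) (b t) (c t) (d t) (e t)
      (g₁ t) (g₂ t) (g₃ t) (g₄ t) (g₅ t)) U :=
  differentiableOn_contVal hq hU (coeffDiff_vwpNum q hz hy ha hb hc hd he)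
    (coeffDiff_vwpDen q ha h₁ h₂ h₃ h₄ h₅) fun t ht => (hr t ht).good hq0 hq _ _ _ _ _

/-- The parameter f occurs only through y = zf in the factor z - yX. Keeping z and y independent
later allows f → ∞ with zf fixed. -/
lemma phi_eq_vwpSum {q : ℂ} (hq0 : q ≠ 0) (hq : ‖q‖ < 1) {as bs : List ℂ}
    {f a b c d e g₁ g₂ g₃ g₄ g₅ z : ℂ} (hr : VwpReg q z a g₁ g₂ g₃ g₄ g₅)
    (hA : ∀ t n, phiCoeff q as bs n * t ^ n =
      ∏ j ∈ Finset.range n, vwpRatio q t (t * f) a b c d e g₁ g₂ g₃ g₄ g₅ (q ^ j)) :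
    phi q as bs z = vwpSum q z (z * f) a b c d e g₁ g₂ g₃ g₄ g₅ := by
  refine phi_eq_contVal (m := 8) hq (P := fun t => vwpNum q t (t * f) a b c d e) ?_ ?_ ?_ ?_ hr.arg
  · have := coeffDiff_vwpNum q (U := Set.univ) (z := fun t => t) (y := fun t => t * f)
      (a := fun _ => a) (b := fun _ => b) (c := fun _ => c) (d := fun _ => d) (e := fun _ => e)
      (by fun_prop) (by fun_prop) (by fun_prop) (by fun_prop) (by fun_prop) (by fun_prop)
      (by fun_prop)
    exact fun i => differentiableOn_univ.1 (this i)
  · intro t; simp [vwpNum, Polynomial.mul_coeff_zero]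
  · exact fun t ht => { hr with arg := ht }.good hq0 hq _ _ _ _ _
  · intro t n
    rw [hA, ratioTerm_vwp hq0]

/-- The factors with s and -s, and with qs and -qs, multiply in pairs to polynomials in s² = a, so
the choice of square root disappears. -/
lemma W87_eq_vwpSum {q : ℂ} (hq0 : q ≠ 0) (hq : ‖q‖ < 1) {a b c d e f z : ℂ}
    (hr : VwpReg q z a (a * q / b) (a * q / c) (a * q / d) (a * q / e) (a * q / f)) :
    W87 q a b c d e f z = vwpSum q z (z * f) a b c d e (a * q / b) (a * q / c) (a * q / d)
      (a * q / e) (a * q / f) := by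
  refine phi_eq_vwpSum hq0 hq hr fun t n => ?_
  have hs : (a ^ (1 / 2 : ℂ)) ^ 2 = a := by
    rw [one_div]; exact Complex.cpow_nat_inv_pow a two_ne_zero
  generalize a ^ (1 / 2 : ℂ) = s at hs
  simp only [phiCoeff, qPoch, List.map_cons, List.map_nil, List.prod_cons, List.prod_nil, mul_one,
    ← Finset.prod_mul_distrib, vwpRatio]
  rw [div_mul_eq_mul_div, show t ^ n = ∏ j ∈ Finset.range n, t by simp, ← Finset.prod_mul_distrib,
    ← Finset.prod_div_distrib]
  refine Finset.prod_congr rfl fun j _ => ?_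
  generalize q ^ j = X
  congr 1
  · rw [← hs]; ring
  · generalize a * q / b = g₁, a * q / c = g₂, a * q / d = g₃, a * q / e = g₄, a * q / f = g₅
    rw [← hs]; ring

/-- Base 0 switches off the very-well-poised factors and zero parameters the others, so the ₃φ₂
inherits the same holomorphy statement. -/
lemma phi32_eq_vwpSum {q : ℂ} (hq0 : q ≠ 0) (hq : ‖q‖ < 1) {f b c g₁ g₂ z : ℂ} (hz : Reg q z)
    (h₁ : Reg q g₁) (h₂ : Reg q g₂) :
    phi q [f, b, c] [g₁, g₂] z = vwpSum q z (z * f) 0 b c 0 0 g₁ g₂ 0 0 0 := by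
  refine phi_eq_vwpSum hq0 hq ⟨hz, reg_zero _, h₁, h₂, reg_zero _, reg_zero _, reg_zero _⟩
    fun t n => ?_
  simp only [phiCoeff, qPoch, List.map_cons, List.map_nil, List.prod_cons, List.prod_nil, mul_one,
    ← Finset.prod_mul_distrib, vwpRatio]
  rw [div_mul_eq_mul_div, show t ^ n = ∏ j ∈ Finset.range n, t by simp, ← Finset.prod_mul_distrib,
    ← Finset.prod_div_distrib]
  refine Finset.prod_congr rfl fun j _ => ?_
  congr 1 <;> ring

lemma vwpSum_eq_tsum {q : ℂ} (hq0 : q ≠ 0) (hq : ‖q‖ < 1) {z y a b c d e g₁ g₂ g₃ g₄ g₅ : ℂ}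
    (hr : VwpReg q z a g₁ g₂ g₃ g₄ g₅) (hz : ‖z‖ < 1) :
    vwpSum q z y a b c d e g₁ g₂ g₃ g₄ g₅ =
      ∑' n, ∏ j ∈ Finset.range n, vwpRatio q z y a b c d e g₁ g₂ g₃ g₄ g₅ (q ^ j) := by
  have h0 : (vwpNum q z y a b c d e).coeff 0 = z := by simp [vwpNum, Polynomial.mul_coeff_zero]
  rw [vwpSum, (hr.good hq0 hq y b c d e).contVal_eq_tsum hq (by rwa [h0])]
  simp only [ratioTerm_vwp hq0]

/-! ### The contiguous relation. -/

/-- The coefficient `C` of the contiguous relation, in terms of the reciprocal parameter `F`. -/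
noncomputable def ctgC (q a b c d e F : ℂ) : ℂ :=
  -((1 - a * q * F / b) * (1 - a * q * F / c) * (1 - a * q * F / d) * (1 - a * q * F / e) /
    (1 - a * q * F))

/-- The coefficient `D` of the contiguous relation. -/
noncomputable def ctgD (q a b c d e F : ℂ) : ℂ :=
  -(q * (1 - F) * (1 - a * F) * (1 - a ^ 2 * q * F / (b * c * d * e)))

/-- The middle coefficient of the contiguous relation. -/
noncomputable def ctgM (q a b c d e F : ℂ) : ℂ :=
  ctgC q a b c d e F + ctgD q a b c d e F +
    a ^ 2 * q ^ 2 * F ^ 2 / (b * c * d * e) *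
      ((1 - b) * (1 - c) * (1 - d) * (1 - e) / (1 - a * q * F))

/-- The very-well-poised function `W(a; b, c, d, e, 1/F; a²q²F/(bcde))`, holomorphic at `F = 0`. -/
noncomputable def wSum (q a b c d e F : ℂ) : ℂ :=
  vwpSum q (a ^ 2 * q ^ 2 / (b * c * d * e) * F) (a ^ 2 * q ^ 2 / (b * c * d * e)) a b c d e
    (a * q / b) (a * q / c) (a * q / d) (a * q / e) (a * q * F)

/-- The terms of the series `wSum`. -/
noncomputable def wTerm (q a b c d e F : ℂ) (n : ℕ) : ℂ :=
  ∏ j ∈ Finset.range n, vwpRatio q (a ^ 2 * q ^ 2 / (b * c * d * e) * F)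
    (a ^ 2 * q ^ 2 / (b * c * d * e)) a b c d e
    (a * q / b) (a * q / c) (a * q / d) (a * q / e) (a * q * F) (q ^ j)

/-- The nonsingularity conditions on `wSum` that do not involve `F`. -/
structure BaseReg (q a b c d e : ℂ) : Prop where
  a_ne : a ≠ 0
  b_ne : b ≠ 0
  c_ne : c ≠ 0
  d_ne : d ≠ 0
  e_ne : e ≠ 0
  base : Reg (q ^ 2) a
  low_b : Reg q (a * q / b)
  low_c : Reg q (a * q / c)
  low_d : Reg q (a * q / d)
  low_e : Reg q (a * q / e)

/-- The part of the term ratio of `wSum` that does not depend on `F`. -/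
noncomputable def wBase (q a b c d e Y : ℂ) : ℂ :=
  (1 - a * Y) * (1 - b * Y) * (1 - c * Y) * (1 - d * Y) * (1 - e * Y) /
    ((1 - q * Y) * (1 - a * q / b * Y) * (1 - a * q / c * Y) * (1 - a * q / d * Y) *
      (1 - a * q / e * Y))

/-- The common factor of the `n + 1`-st terms of contiguous series. -/
noncomputable def wCommon (q a b c d e F : ℂ) : ℕ → ℂ
  | 0 => a ^ 2 * q ^ 2 / (b * c * d * e) * wBase q a b c d e 1 / ((1 - a) * (1 - a * q * F))
  | n + 1 => wCommon q a b c d e F n * (a ^ 2 * q ^ 2 / (b * c * d * e) * (F - q ^ n) *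
      wBase q a b c d e (q ^ (n + 1)) / (1 - a * q * F * q ^ (n + 1)))

lemma vwpRatio_eq (q a b c d e F u Y : ℂ) :
    vwpRatio q (u * F) u a b c d e (a * q / b) (a * q / c) (a * q / d) (a * q / e) (a * q * F) Y =
      u * (F - Y) * (1 - a * q ^ 2 * Y ^ 2) / ((1 - a * Y ^ 2) * (1 - a * q * F * Y)) *
        wBase q a b c d e Y := by
  rw [vwpRatio, wBase, div_mul_div_comm]
  congr 1 <;> ring

lemma wTerm_succ (q a b c d e F : ℂ) (n : ℕ) :
    wTerm q a b c d e F (n + 1) = wTerm q a b c d e F n *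
      (a ^ 2 * q ^ 2 / (b * c * d * e) * (F - q ^ n) * (1 - a * q ^ 2 * (q ^ n) ^ 2) /
        ((1 - a * (q ^ n) ^ 2) * (1 - a * q * F * q ^ n)) * wBase q a b c d e (q ^ n)) := by
  rw [wTerm, Finset.prod_range_succ, vwpRatio_eq, wTerm]

lemma wTerm_zero (q a b c d e F : ℂ) : wTerm q a b c d e F 0 = 1 := by simp [wTerm]

lemma Reg.one_sub_ne {q x : ℂ} (h : Reg q x) (k : ℕ) : 1 - x * q ^ k ≠ 0 :=
  sub_ne_zero.2 (h k).symm

lemma Reg.one_sub_sq_ne {q x : ℂ} (h : Reg (q ^ 2) x) (k : ℕ) : 1 - x * (q ^ k) ^ 2 ≠ 0 :=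
  sub_ne_zero.2 (by have := (h k).symm; rwa [← pow_mul, mul_comm 2 k, pow_mul] at this)

/-- The factors (1 - aq^{2j+2})/(1 - aq^{2j}) telescope. `wCommon` keeps only F - q^j with j < n,
which are shared with the series at Fq and at F/q. -/
lemma wTerm_eq_common {q a : ℂ} (hb : Reg (q ^ 2) a) (b c d e : ℂ) {F : ℂ}
    (hF : Reg q (a * q * F)) (n : ℕ) :
    wTerm q a b c d e F (n + 1) = (1 - a * q ^ 2 * (q ^ n) ^ 2) * (F - q ^ n) *
      wCommon q a b c d e F n := by
  have hk : ∀ n, 1 - a * q ^ 2 * (q ^ n) ^ 2 ≠ 0 := fun n => by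
    have := hb.one_sub_sq_ne (n + 1)
    rwa [show a * q ^ 2 * (q ^ n) ^ 2 = a * (q ^ (n + 1)) ^ 2 by ring]
  induction n with
  | zero =>
    have h1 := sub_ne_zero.2 hb.ne_one.symm
    have h2 := sub_ne_zero.2 hF.ne_one.symm
    rw [wTerm_succ, wTerm_zero, wCommon]
    simp only [pow_zero, one_pow, mul_one]
    field_simp
  | succ n ih =>
    have h1 := hk n
    have h2 := hF.one_sub_ne (n + 1)
    rw [wTerm_succ, ih, wCommon]
    generalize wBase q a b c d e (q ^ (n + 1)) = w
    rw [show a * (q ^ (n + 1)) ^ 2 = a * q ^ 2 * (q ^ n) ^ 2 by ring]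
    field_simp

lemma contiguous_up_step {q F X Y t k₁ k₂ k₃ K p s M u w : ℂ} (h₁ : k₁ ≠ 0) (h₂ : k₂ ≠ 0)
    (h₃ : k₃ ≠ 0) (hY : Y = q * X) (ih : t * k₂ = k₁ * s * X * p * M) :
    t * (u * (F * q - Y) * K / (k₁ * k₃) * w) * k₃ =
      K * s * Y * p * (M * (u * (F - X) * w / k₂)) := by
  rw [eq_div_of_mul_eq h₂ ih, hY, show F * q - q * X = q * (F - X) by ring]
  field_simp

lemma contiguous_down_step {q F X Y t k₁ k₂ k₃ K p s M u w : ℂ} (hq0 : q ≠ 0) (h₁ : k₁ ≠ 0)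
    (h₂ : k₂ ≠ 0) (h₃ : k₃ ≠ 0) (hY : Y = q * X)
    (ih : s * (t * p) * (q * X) = -(k₁ * (F - X) * (F - q * X) * k₂ * M)) :
    s * (t * (u * (F / q - Y) * K / (k₁ * k₂) * w) * p) * (q * Y) =
      -(K * (F - Y) * (F - q * Y) * k₃ * (M * (u * (F - X) * w / k₃))) := by
  have h : F / q - Y = (F - q * Y) / q := by field_simp
  rw [h]
  subst hY
  generalize F - q * (q * X) = r
  have : t * s * p * (q * X) * (u * r * K * w) =
      -(k₁ * (F - X) * (F - q * X) * k₂ * M) * (u * r * K * w) := by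
    rw [← ih]; ring
  field_simp
  linear_combination this

lemma wTerm_mul_eq_common {q a : ℂ} (hb : Reg (q ^ 2) a) (b c d e : ℂ) {F : ℂ}
    (hF : Reg q (a * q * F)) (n : ℕ) :
    wTerm q a b c d e (F * q) (n + 1) * (1 - a * q * F * q ^ (n + 1)) =
      (1 - a * q ^ 2 * (q ^ n) ^ 2) * (F * q - 1) * q ^ n * (1 - a * q * F) *
      wCommon q a b c d e F n := by
  have hk : ∀ n, 1 - a * q ^ 2 * (q ^ n) ^ 2 ≠ 0 := fun n => by
    have := hb.one_sub_sq_ne (n + 1)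
    rwa [show a * q ^ 2 * (q ^ n) ^ 2 = a * (q ^ (n + 1)) ^ 2 by ring]
  induction n with
  | zero =>
    have h1 := sub_ne_zero.2 hb.ne_one.symm
    have h2 := sub_ne_zero.2 hF.ne_one.symm
    have h3 := hF.one_sub_ne 1
    rw [wTerm_succ, wTerm_zero, wCommon]
    simp only [pow_zero, one_pow, mul_one, zero_add, pow_one] at h3 ⊢
    rw [show a * q * (F * q) = a * q * F * q by ring]
    generalize a ^ 2 * q ^ 2 / (b * c * d * e) = u
    generalize 1 - a * q * F * q = k at *
    generalize 1 - a * q * F = k' at *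
    field_simp
  | succ n ih =>
    rw [wTerm_succ, wCommon]
    generalize a ^ 2 * q ^ 2 / (b * c * d * e) = u
    rw [show a * (q ^ (n + 1)) ^ 2 = a * q ^ 2 * (q ^ n) ^ 2 by ring,
      show a * q * (F * q) * q ^ (n + 1) = a * q * F * q ^ (n + 2) by ring,
      show n + 1 + 1 = n + 2 from rfl]
    exact contiguous_up_step (hk n) (hF.one_sub_ne (n + 1)) (hF.one_sub_ne (n + 2))
      (pow_succ' q n) ih

/-- Up to powers of q, the product of the F/q - q^j runs over F - q^i with 1 ≤ i ≤ n + 1. The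
multiplier 1 - F supplies i = 0; both multipliers 1 - F and 1 - aF occur in D. -/
lemma wTerm_div_eq_common {q a : ℂ} (hq0 : q ≠ 0) (hb : Reg (q ^ 2) a) (b c d e : ℂ) {F : ℂ}
    (hF : Reg q (a * F)) (n : ℕ) :
    (1 - F) * (wTerm q a b c d e (F / q) (n + 1) * (1 - a * F)) * (q * q ^ n) =
      -((1 - a * q ^ 2 * (q ^ n) ^ 2) * (F - q ^ n) * (F - q * q ^ n) *
        (1 - a * F * q ^ (n + 1)) * wCommon q a b c d e F n) := by
  have hk : ∀ n, 1 - a * q ^ 2 * (q ^ n) ^ 2 ≠ 0 := fun n => by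
    have := hb.one_sub_sq_ne (n + 1)
    rwa [show a * q ^ 2 * (q ^ n) ^ 2 = a * (q ^ (n + 1)) ^ 2 by ring]
  induction n with
  | zero =>
    have h1 := sub_ne_zero.2 hb.ne_one.symm
    have h2 := sub_ne_zero.2 hF.ne_one.symm
    have h3 := hF.one_sub_ne 1
    rw [wTerm_succ, wTerm_zero, wCommon]
    simp only [pow_zero, one_pow, mul_one, zero_add, pow_one] at h3 ⊢
    rw [show a * q * (F / q) = a * F by field_simp, show a * q * F = a * F * q by ring]
    generalize a ^ 2 * q ^ 2 / (b * c * d * e) = u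
    generalize 1 - a * F * q = k at *
    generalize 1 - a * F = k' at *
    field_simp
    ring
  | succ n ih =>
    rw [wTerm_succ, wCommon]
    generalize a ^ 2 * q ^ 2 / (b * c * d * e) = u
    rw [show a * (q ^ (n + 1)) ^ 2 = a * q ^ 2 * (q ^ n) ^ 2 by ring,
      show a * q * (F / q) * q ^ (n + 1) = a * F * q ^ (n + 1) by field_simp,
      show a * q * F * q ^ (n + 1) = a * F * q ^ (n + 1 + 1) by ring]
    exact contiguous_down_step hq0 (hk n) (hF.one_sub_ne (n + 1)) (hF.one_sub_ne (n + 1 + 1))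
      (pow_succ' q n) ih

/-- The summand identity behind the contiguous relation, with the parameters `b, c, d, e` entering
through their elementary symmetric functions. -/
lemma contiguous_identity {q a F X s e₁ e₂ e₃ C D M L t₀ t₁ t₂ G₁ G₂ w : ℂ} {E P : ℂ → ℂ}
    (hq0 : q ≠ 0) (hX : X ≠ 0) (hs : s ≠ 0) (h₁ : 1 - a * q * F ≠ 0)
    (h₃ : 1 - a * q ^ 2 * F * X ≠ 0)
    (hE : ∀ Y, E Y = 1 - e₁ * Y + e₂ * Y ^ 2 - e₃ * Y ^ 3 + s * Y ^ 4)
    (hP : ∀ Y, s * P Y = s - e₃ * (a * q * Y) + e₂ * (a * q * Y) ^ 2 - e₁ * (a * q * Y) ^ 3 +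
      (a * q * Y) ^ 4)
    (hC : C * (1 - a * q * F) = -P F)
    (hD : D = (1 - F) * (1 - a * F) * L) (hL : s * L = -(q * (s - a ^ 2 * q * F)))
    (hM : s * (M - C - D) * (1 - a * q * F) = a ^ 2 * q ^ 2 * F ^ 2 * E 1)
    (h0 : t₀ = (1 - a * q ^ 2 * X ^ 2) * (F - X) * w)
    (hu : t₁ * (1 - a * q ^ 2 * F * X) =
      (1 - a * q ^ 2 * X ^ 2) * (F * q - 1) * X * (1 - a * q * F) * w)
    (hd : (1 - F) * (t₂ * (1 - a * F)) * (q * X) =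
      -((1 - a * q ^ 2 * X ^ 2) * (F - X) * (F - q * X) * (1 - a * q * F * X) * w))
    (hG₁ : G₁ * X = -(F ^ 2 * (1 - q * X) * P X * w))
    (hG₂ : s * (G₂ * (q * X)) * (1 - a * q ^ 2 * F * X) =
      -(F ^ 2 * a ^ 2 * q ^ 2 * (1 - a * q * X) * E (q * X) * (F - X) * w)) :
    C * t₁ - M * t₀ + D * t₂ = G₂ - G₁ := by
  have hK : s * (1 - a * q ^ 2 * F * X) * (q * X) * (1 - a * q * F) ≠ 0 :=
    mul_ne_zero (mul_ne_zero (mul_ne_zero hs h₃) (mul_ne_zero hq0 hX)) h₁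
  rw [← sub_eq_zero, ← mul_right_inj' hK, mul_zero]
  have hEq := hE (q * X)
  have hE1 := hE 1
  have hPF := hP F
  have hPX := hP X
  obtain ⟨k₁, hk₁⟩ : ∃ k, k = 1 - a * q * F := ⟨_, rfl⟩
  obtain ⟨k₃, hk₃⟩ : ∃ k, k = 1 - a * q ^ 2 * F * X := ⟨_, rfl⟩
  obtain ⟨N, hN⟩ : ∃ k, k = 1 - a * q ^ 2 * X ^ 2 := ⟨_, rfl⟩
  rw [← hk₁] at hC hM hu ⊢
  rw [← hk₃] at hu hG₂ ⊢
  rw [← hN] at h0 hu hd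
  -- Substituting every hypothesis linearly leaves `w` times a polynomial, with `k₁`, `k₃`, `N` kept
  -- as atoms; it vanishes identically once these are expanded.
  have step : s * k₃ * (q * X) * k₁ * (C * t₁ - M * t₀ + D * t₂ - (G₂ - G₁)) =
      w * (-(q * X * N * (F * q - 1) * X * k₁) *
            (s - e₃ * (a * q * F) + e₂ * (a * q * F) ^ 2 - e₁ * (a * q * F) ^ 3 + (a * q * F) ^ 4)
        - k₃ * (q * X) * N * (F - X) * (a ^ 2 * q ^ 2 * F ^ 2 * (1 - e₁ + e₂ - e₃ + s)
            - (s - e₃ * (a * q * F) + e₂ * (a * q * F) ^ 2 - e₁ * (a * q * F) ^ 3 +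
                (a * q * F) ^ 4)
            - k₁ * (1 - F) * (1 - a * F) * (q * (s - a ^ 2 * q * F)))
        + N * (F - X) * (F - q * X) * (1 - a * q * F * X) * k₁ * k₃ * (q * (s - a ^ 2 * q * F))
        + k₁ * F ^ 2 * a ^ 2 * q ^ 2 * (1 - a * q * X) * (F - X) *
            (1 - e₁ * (q * X) + e₂ * (q * X) ^ 2 - e₃ * (q * X) ^ 3 + s * (q * X) ^ 4)
        - k₁ * k₃ * q * F ^ 2 * (1 - q * X) *
            (s - e₃ * (a * q * X) + e₂ * (a * q * X) ^ 2 - e₁ * (a * q * X) ^ 3 +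
              (a * q * X) ^ 4)) := by
    linear_combination (s * q * X * t₁ * k₃) * hC - (s * q * X * P F) * hu -
      (q * X * N * (F * q - 1) * X * k₁ * w) * hPF - (s * k₃ * (q * X) * k₁ * M) * h0 -
      (k₃ * q * X * N * (F - X) * w) * hM -
      (k₃ * q * X * N * (F - X) * w * a ^ 2 * q ^ 2 * F ^ 2) * hE1 -
      (k₃ * q * X * N * (F - X) * w * s) * hC + (k₃ * q * X * N * (F - X) * w) * hPF -
      (k₃ * q * X * N * (F - X) * w * s * k₁) * hD -
      (k₃ * q * X * N * (F - X) * w * k₁ * (1 - F) * (1 - a * F)) * hL +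
      (s * k₃ * (q * X) * k₁ * t₂) * hD + (s * L * k₁ * k₃) * hd -
      (N * (F - X) * (F - q * X) * (1 - a * q * F * X) * w * k₁ * k₃) * hL - k₁ * hG₂ +
      (k₁ * F ^ 2 * a ^ 2 * q ^ 2 * (1 - a * q * X) * (F - X) * w) * hEq +
      (s * k₁ * k₃ * q) * hG₁ - (k₁ * k₃ * q * F ^ 2 * (1 - q * X) * w) * hPX
  rw [step]
  refine mul_eq_zero_of_right _ ?_
  rw [hk₁, hk₃, hN]
  ring

/-- The sum of the first `K + 1` terms of the contiguous relation. -/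
theorem sum_contiguous {q a b c d e F : ℂ} (hq0 : q ≠ 0) (hq : ‖q‖ < 1) (hr : BaseReg q a b c d e)
    (hF : Reg q (a * F)) (K : ℕ) :
    ∑ k ∈ Finset.range (K + 1), (ctgC q a b c d e F * wTerm q a b c d e (F * q) k -
        ctgM q a b c d e F * wTerm q a b c d e F k +
        ctgD q a b c d e F * wTerm q a b c d e (F / q) k) =
      -(F ^ 2 / q ^ K * (1 - q * q ^ K) * ((1 - a * q / b * q ^ K) * (1 - a * q / c * q ^ K) *
        (1 - a * q / d * q ^ K) * (1 - a * q / e * q ^ K)) * wCommon q a b c d e F K) := by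
  have hb := hr.b_ne
  have hc := hr.c_ne
  have hd := hr.d_ne
  have he := hr.e_ne
  have hF' : Reg q (a * q * F) := by rw [mul_right_comm]; exact hF.mul_self
  have h1 := sub_ne_zero.2 hF'.ne_one.symm
  induction K with
  | zero =>
    have hgq := sub_ne_zero.2 (reg_self hq).ne_one.symm
    have hgb := sub_ne_zero.2 hr.low_b.ne_one.symm
    have hgc := sub_ne_zero.2 hr.low_c.ne_one.symm
    have hgd := sub_ne_zero.2 hr.low_d.ne_one.symm
    have hge := sub_ne_zero.2 hr.low_e.ne_one.symm
    have h4 := sub_ne_zero.2 hr.base.ne_one.symm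
    simp only [zero_add, Finset.range_one, Finset.sum_singleton, wTerm_zero, wCommon, pow_zero,
      mul_one, ctgM, wBase]
    generalize ctgC q a b c d e F = C, ctgD q a b c d e F = D
    generalize 1 - a * q / b = gb, 1 - a * q / c = gc, 1 - a * q / d = gd,
      1 - a * q / e = ge at *
    generalize 1 - a * q * F = k, 1 - q = gq at *
    generalize 1 - a = ka at *
    field_simp
    ring
  | succ K ih =>
    rw [Finset.sum_range_succ, ih, ← eq_sub_iff_add_eq', sub_neg_eq_add]
    have h4 := hF'.one_sub_ne (K + 1)
    rw [show a * q * F * q ^ (K + 1) = a * q ^ 2 * F * q ^ K by ring] at h4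
    -- `G₁` and `G₂` are the claimed antidifference at K and K + 1. `L` is D stripped of (1 - F)(1 -
    -- aF), the factors used up by `wTerm_div_eq_common`.
    have key := contiguous_identity (q := q) (a := a) (F := F) (X := q ^ K) (s := b * c * d * e)
      (e₁ := b + c + d + e) (e₂ := b * c + b * d + b * e + c * d + c * e + d * e)
      (e₃ := b * c * d + b * c * e + b * d * e + c * d * e) (C := ctgC q a b c d e F)
      (D := ctgD q a b c d e F) (M := ctgM q a b c d e F)
      (L := -(q * (1 - a ^ 2 * q * F / (b * c * d * e))))
      (t₀ := wTerm q a b c d e F (K + 1)) (t₁ := wTerm q a b c d e (F * q) (K + 1))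
      (t₂ := wTerm q a b c d e (F / q) (K + 1)) (w := wCommon q a b c d e F K)
      (E := fun Y => (1 - b * Y) * (1 - c * Y) * (1 - d * Y) * (1 - e * Y))
      (P := fun Y => (1 - a * q / b * Y) * (1 - a * q / c * Y) * (1 - a * q / d * Y) *
        (1 - a * q / e * Y))
      (G₁ := -(F ^ 2 / q ^ K * (1 - q * q ^ K) * ((1 - a * q / b * q ^ K) *
        (1 - a * q / c * q ^ K) * (1 - a * q / d * q ^ K) * (1 - a * q / e * q ^ K)) *
        wCommon q a b c d e F K))
      (G₂ := -(F ^ 2 / q ^ (K + 1) * (1 - q * q ^ (K + 1)) * ((1 - a * q / b * q ^ (K + 1)) *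
        (1 - a * q / c * q ^ (K + 1)) * (1 - a * q / d * q ^ (K + 1)) *
        (1 - a * q / e * q ^ (K + 1))) * wCommon q a b c d e F (K + 1)))
      hq0 (pow_ne_zero K hq0) (by simp [hb, hc, hd, he]) h1 h4 (fun Y => by ring)
      (fun Y => by field_simp; ring) ?_ ?_ ?_ ?_ (wTerm_eq_common hr.base b c d e hF' K) ?_ ?_ ?_ ?_
    · rw [key]; ring
    · rw [ctgC, neg_mul, div_mul_cancel₀ _ h1]
      ring
    · rw [ctgD]; ring
    · field_simp
    · rw [ctgM]
      generalize ctgC q a b c d e F = C, ctgD q a b c d e F = D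
      generalize 1 - a * q * F = k at *
      field_simp
      ring
    · rw [← wTerm_mul_eq_common hr.base b c d e hF' K]; ring
    · rw [wTerm_div_eq_common hq0 hr.base b c d e hF K]; ring
    · field_simp
    · rw [wCommon, wBase, show a * q * F * q ^ (K + 1) = a * q ^ 2 * F * q ^ K by ring]
      have hgq := (reg_self hq).one_sub_ne (K + 1)
      have hgb := hr.low_b.one_sub_ne (K + 1)
      have hgc := hr.low_c.one_sub_ne (K + 1)
      have hgd := hr.low_d.one_sub_ne (K + 1)
      have hge := hr.low_e.one_sub_ne (K + 1)
      rw [show q * q ^ K = q ^ (K + 1) by ring,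
        show 1 - a * q * q ^ K = 1 - a * q ^ (K + 1) by ring]
      have hX := pow_ne_zero (K + 1) hq0
      generalize q ^ (K + 1) = Y at *
      generalize 1 - a * q / b * Y = gb, 1 - a * q / c * Y = gc, 1 - a * q / d * Y = gd,
        1 - a * q / e * Y = ge, 1 - a * q ^ 2 * F * q ^ K = k, 1 - q * Y = gq at *
      generalize (1 - b * Y) = kb, (1 - c * Y) = kc, (1 - d * Y) = kd, (1 - e * Y) = ke,
        (1 - a * Y) = ka, F - q ^ K = r
      field_simp

/-- The sum of a terminating series. -/
noncomputable def wFin (q a b c d e : ℂ) (N : ℕ) : ℂ :=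
  ∑ k ∈ Finset.range (N + 1), wTerm q a b c d e (q ^ N) k

lemma wTerm_eq_zero (q a b c d e : ℂ) {N k : ℕ} (h : N < k) :
    wTerm q a b c d e (q ^ N) k = 0 := by
  refine Finset.prod_eq_zero (Finset.mem_range.2 h) ?_
  rw [vwpRatio_eq]; simp

lemma wCommon_eq_zero (q a b c d e : ℂ) {N k : ℕ} (h : N < k) :
    wCommon q a b c d e (q ^ N) k = 0 := by
  induction k with
  | zero => simp at h
  | succ k ih =>
    rw [wCommon]
    rcases (Nat.lt_succ_iff.1 h).eq_or_lt with rfl | h'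
    · simp
    · simp [ih h']

lemma sum_wTerm_eq_wFin (q a b c d e : ℂ) {N K : ℕ} (h : N < K) :
    ∑ k ∈ Finset.range K, wTerm q a b c d e (q ^ N) k = wFin q a b c d e N := by
  refine (Finset.sum_subset (Finset.range_subset_range.2 h) fun k _ hk => ?_).symm
  exact wTerm_eq_zero _ _ _ _ _ _ (by simpa using hk)

/-- At F = q^{N+1} the telescoped remainder contains the factor F - q^{N+1}, so summing far enough
leaves nothing. -/
lemma wFin_contiguous {q a b c d e : ℂ} (hq0 : q ≠ 0) (hq : ‖q‖ < 1) (hr : BaseReg q a b c d e)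
    {N : ℕ} (ha : Reg q (a * q ^ (N + 1))) :
    ctgC q a b c d e (q ^ (N + 1)) * wFin q a b c d e (N + 2) -
        ctgM q a b c d e (q ^ (N + 1)) * wFin q a b c d e (N + 1) +
      ctgD q a b c d e (q ^ (N + 1)) * wFin q a b c d e N = 0 := by
  have h := sum_contiguous hq0 hq hr ha (N + 2)
  rw [wCommon_eq_zero _ _ _ _ _ _ (by omega : N + 1 < N + 2), mul_zero, neg_zero,
    Finset.sum_add_distrib, Finset.sum_sub_distrib, ← Finset.mul_sum, ← Finset.mul_sum,
    ← Finset.mul_sum, show q ^ (N + 1) * q = q ^ (N + 2) by ring,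
    show q ^ (N + 1) / q = q ^ N by rw [pow_succ]; field_simp,
    sum_wTerm_eq_wFin _ _ _ _ _ _ (by omega), sum_wTerm_eq_wFin _ _ _ _ _ _ (by omega),
    sum_wTerm_eq_wFin _ _ _ _ _ _ (by omega)] at h
  exact h

/-- D contains 1 - F, so at F = 1 the relation has only two terms and determines the value at N = 1
from that at N = 0. -/
lemma wFin_contiguous_zero {q a b c d e : ℂ} (hq0 : q ≠ 0) (hq : ‖q‖ < 1)
    (hr : BaseReg q a b c d e) (ha : Reg q a) :
    ctgC q a b c d e 1 * wFin q a b c d e 1 - ctgM q a b c d e 1 * wFin q a b c d e 0 = 0 := by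
  have h := sum_contiguous hq0 hq hr (F := 1) (by simpa using ha) 1
  have hD : ctgD q a b c d e 1 = 0 := by simp [ctgD]
  have h0 : wCommon q a b c d e 1 1 = 0 := by
    simpa using wCommon_eq_zero q a b c d e (N := 0) (k := 1) one_pos
  have h1 := sum_wTerm_eq_wFin q a b c d e (N := 0) (K := 2) (by omega)
  have h2 := sum_wTerm_eq_wFin q a b c d e (N := 1) (K := 2) (by omega)
  simp only [pow_zero, pow_one] at h1 h2
  simp only [hD, zero_mul, add_zero, h0, mul_zero, neg_zero] at h
  rwa [Finset.sum_sub_distrib, ← Finset.mul_sum, ← Finset.mul_sum, one_mul, h1, h2] at h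

lemma wFin_zero (q a b c d e : ℂ) : wFin q a b c d e 0 = 1 := by simp [wFin, wTerm_zero]

lemma BaseReg.vwpReg {q a b c d e : ℂ} (hr : BaseReg q a b c d e) {F : ℂ}
    (hz : Reg q (a ^ 2 * q ^ 2 / (b * c * d * e) * F)) (hF : Reg q (a * q * F)) :
    VwpReg q (a ^ 2 * q ^ 2 / (b * c * d * e) * F) a (a * q / b) (a * q / c) (a * q / d)
      (a * q / e) (a * q * F) :=
  ⟨hz, hr.base, hr.low_b, hr.low_c, hr.low_d, hr.low_e, hF⟩

lemma reg_of_norm_lt_one {q x : ℂ} (hq : ‖q‖ < 1) (hx : ‖x‖ < 1) : Reg q x := fun k h => by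
  have h1 := norm_mul_pow_lt_one hq (Nat.zero_le k) (x := x) (by simpa using hx)
  rw [h] at h1
  simp at h1

/-- Large N brings the argument into the unit disc, where `wSum` is its own, here terminating,
series. -/
lemma wSum_eq_wFin {q a b c d e : ℂ} (hq0 : q ≠ 0) (hq : ‖q‖ < 1) (hr : BaseReg q a b c d e) :
    ∀ᶠ N : ℕ in atTop, wSum q a b c d e (q ^ N) = wFin q a b c d e N := by
  filter_upwards [eventually_norm_mul_pow_lt_one hq (a ^ 2 * q ^ 2 / (b * c * d * e)),
    eventually_norm_mul_pow_lt_one hq (a * q)] with N h1 h2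
  rw [wSum, vwpSum_eq_tsum hq0 hq (hr.vwpReg (reg_of_norm_lt_one hq h1)
    (reg_of_norm_lt_one hq h2)) h1, wFin]
  exact tsum_eq_sum fun k hk => wTerm_eq_zero q a b c d e (by simpa using hk)

lemma differentiableOn_wSum {q a b c d e : ℂ} (hq0 : q ≠ 0) (hq : ‖q‖ < 1)
    (hr : BaseReg q a b c d e) (k : ℂ) {U : Set ℂ} (hU : IsOpen U)
    (hz : ∀ F ∈ U, Reg q (a ^ 2 * q ^ 2 / (b * c * d * e) * (F * k)))
    (hF : ∀ F ∈ U, Reg q (a * q * (F * k))) :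
    DifferentiableOn ℂ (fun F => wSum q a b c d e (F * k)) U := by
  unfold wSum
  refine differentiableOn_vwpSum hq0 hq hU ?_ ?_ ?_ ?_ ?_ ?_ ?_ ?_ ?_ ?_ ?_ ?_
    fun F h => hr.vwpReg (hz F h) (hF F h) <;> fun_prop

lemma reg_zero_mem (q u : ℂ) : (0 : ℂ) ∈ {F | Reg q (u * F)} := by simpa using reg_zero q

/-- The three-term contiguous relation. -/
theorem wSum_contiguous {q a b c d e F : ℂ} (hq0 : q ≠ 0) (hq : ‖q‖ < 1) (hr : BaseReg q a b c d e)
    (hF : Reg q (a * F)) (hz : Reg q (a ^ 2 * q / (b * c * d * e) * F)) :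
    ctgC q a b c d e F * wSum q a b c d e (F * q) - ctgM q a b c d e F * wSum q a b c d e F +
      ctgD q a b c d e F * wSum q a b c d e (F / q) = 0 := by
  set u := a ^ 2 * q / (b * c * d * e) with hu
  set U : Set ℂ := {F | Reg q (a * F)} ∩ {F | Reg q (u * F)} with hUdef
  have hU : IsOpen U := (isOpen_setOf_reg_mul hq a).inter (isOpen_setOf_reg_mul hq u)
  have huq : a ^ 2 * q ^ 2 / (b * c * d * e) = u * q := by rw [hu]; ring
  -- k = 0, 1, 2 give the arguments F/q, F, Fq. The domain is dictated by F/q and serves all three.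
  have hd : ∀ k : ℕ, DifferentiableOn ℂ (fun F => wSum q a b c d e (F * (q ^ k / q))) U := by
    intro k
    refine differentiableOn_wSum hq0 hq hr _ hU (fun F h => ?_) fun F h => ?_
    · have : a ^ 2 * q ^ 2 / (b * c * d * e) * (F * (q ^ k / q)) = u * F * q ^ k := by
        rw [huq]; field_simp
      rw [this]; exact Reg.mul_pow h.2 k
    · have : a * q * (F * (q ^ k / q)) = a * F * q ^ k := by field_simp
      rw [this]; exact Reg.mul_pow h.1 k
  have h0 := hd 0
  have h1 := hd 1
  have h2 := hd 2
  simp only [pow_zero, pow_one, div_self hq0, mul_one, one_div, ← div_eq_mul_inv,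
    show q ^ 2 / q = q by rw [pow_two]; field_simp] at h0 h1 h2
  have hk : ∀ F ∈ U, 1 - a * q * F ≠ 0 := fun F h => by
    have := h.1.mul_self.ne_one
    exact sub_ne_zero.2 (by rw [mul_right_comm]; exact this.symm)
  have hC : DifferentiableOn ℂ (ctgC q a b c d e) U := by
    unfold ctgC
    exact (DifferentiableOn.fun_div (by fun_prop) (by fun_prop) hk).fun_neg
  have hD : DifferentiableOn ℂ (ctgD q a b c d e) U := by unfold ctgD; fun_prop
  have hM : DifferentiableOn ℂ (ctgM q a b c d e) U := by
    unfold ctgM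
    exact (hC.fun_add hD).fun_add (DifferentiableOn.fun_mul (by fun_prop)
      (DifferentiableOn.fun_div (by fun_prop) (by fun_prop) hk))
  refine eqOn_of_eq_pow hq0 hq (g := fun _ => 0) hU ?_ ⟨reg_zero_mem q a, reg_zero_mem q u⟩
    (((hC.fun_mul h2).fun_sub (hM.fun_mul h1)).fun_add (hD.fun_mul h0)) (differentiableOn_const _) ?_
    (⟨hF, hz⟩ : F ∈ U)
  · rw [hUdef, Set.compl_inter]
    exact (countable_compl_reg_mul q a).union (countable_compl_reg_mul q u)
  · obtain ⟨N₀, hN₀⟩ := eventually_atTop.1 ((wSum_eq_wFin hq0 hq hr).and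
      (eventually_norm_mul_pow_lt_one hq a))
    filter_upwards [eventually_ge_atTop (N₀ + 1)] with N hN
    obtain ⟨n, rfl⟩ : ∃ n, N = n + 1 := ⟨N - 1, by omega⟩
    rw [show q ^ (n + 1) * q = q ^ (n + 2) by ring,
      show q ^ (n + 1) / q = q ^ n by rw [pow_succ]; field_simp, (hN₀ n (by omega)).1,
      (hN₀ (n + 1) (by omega)).1, (hN₀ (n + 2) (by omega)).1]
    exact wFin_contiguous hq0 hq hr (reg_of_norm_lt_one hq (hN₀ (n + 1) (by omega)).2)

/-! ### The two-term transformation. -/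

lemma ctgC_transform {q a b c d l : ℂ} (hl : l ≠ 0) (e F : ℂ) :
    ctgC q l (l * b / a) (l * c / a) (l * d / a) e F =
      -((1 - a * q * F / b) * (1 - a * q * F / c) * (1 - a * q * F / d) * (1 - l * q * F / e) /
        (1 - l * q * F)) := by
  have h : ∀ x, l * q * F / (l * x / a) = a * q * F / x := fun x => by
    rw [div_div_eq_mul_div, show l * q * F * a = l * (a * q * F) by ring, mul_div_mul_left _ _ hl]
  rw [ctgC, h, h, h]

lemma base_transform {q a b c d e l : ℂ} (ha : a ≠ 0) (hb : b ≠ 0) (hc : c ≠ 0) (hd : d ≠ 0)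
    (he : e ≠ 0) (hl : l ≠ 0) (hlam : l * (b * c * d) = q * a ^ 2) :
    l ^ 2 * q / (l * b / a * (l * c / a) * (l * d / a) * e) = a / e := by
  field_simp
  linear_combination -hlam

lemma base_eq {q a b c d e l : ℂ} (hb : b ≠ 0) (hc : c ≠ 0) (hd : d ≠ 0)
    (he : e ≠ 0) (hlam : l * (b * c * d) = q * a ^ 2) :
    a ^ 2 * q / (b * c * d * e) = l / e := by
  field_simp
  linear_combination -hlam

/-- Of the three coefficients the middle one is invariant under the change of base; the changes in C
and D are absorbed by `trRatio`. Eliminating q through λbcd = qa² makes this a rational identity in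
free variables. -/
lemma ctgM_transform {q a b c d e l F : ℂ} (ha : a ≠ 0) (hb : b ≠ 0) (hc : c ≠ 0) (hd : d ≠ 0)
    (he : e ≠ 0) (hl : l ≠ 0) (hlam : l * (b * c * d) = q * a ^ 2) (h₁ : 1 - a * q * F ≠ 0)
    (h₂ : 1 - l * q * F ≠ 0) :
    ctgM q a b c d e F = ctgM q l (l * b / a) (l * c / a) (l * d / a) e F := by
  have e1 := base_eq (q := q) hb hc hd he hlam
  have e2 := base_transform (q := q) ha hb hc hd he hl hlam
  have e3 : ∀ s F : ℂ, s * q * F / (b * c * d * e) = (s * q / (b * c * d * e)) * F :=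
    fun s F => by ring
  rw [ctgM, ctgM, ctgC_transform hl, ctgC, ctgD, ctgD,
    show a ^ 2 * q * F / (b * c * d * e) = l / e * F by rw [← e1]; ring,
    show l ^ 2 * q * F / (l * b / a * (l * c / a) * (l * d / a) * e) = a / e * F by
      rw [← e2]; ring,
    show a ^ 2 * q ^ 2 * F ^ 2 / (b * c * d * e) = l / e * (q * F ^ 2) by rw [← e1]; ring,
    show l ^ 2 * q ^ 2 * F ^ 2 / (l * b / a * (l * c / a) * (l * d / a) * e) =
      a / e * (q * F ^ 2) by rw [← e2]; ring]
  have hq : q = l * b * c * d / a ^ 2 := by field_simp; linear_combination -hlam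
  rw [← sub_eq_zero]
  obtain ⟨k₁, hk₁⟩ : ∃ k, k = 1 - a * q * F := ⟨_, rfl⟩
  obtain ⟨k₂, hk₂⟩ : ∃ k, k = 1 - l * q * F := ⟨_, rfl⟩
  rw [← hk₁] at h₁ ⊢
  rw [← hk₂] at h₂ ⊢
  field_simp
  rw [hk₁, hk₂, hq]
  field_simp
  ring

/-- The ratio of the two sides of the transformation of terminating series. -/
noncomputable def trRatio (q a e l : ℂ) (N : ℕ) : ℂ :=
  qPoch q (a * q) N * qPoch q (l * q / e) N / (qPoch q (a * q / e) N * qPoch q (l * q) N)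

lemma qPoch_succ (q x : ℂ) (n : ℕ) : qPoch q x (n + 1) = qPoch q x n * (1 - x * q ^ n) :=
  Finset.prod_range_succ _ _

lemma Reg.qPoch_ne_zero {q x : ℂ} (h : Reg q x) (n : ℕ) : qPoch q x n ≠ 0 :=
  Finset.prod_ne_zero_iff.2 fun k _ => h.one_sub_ne k

lemma BaseReg.transform {q a b c d e l : ℂ} (hr : BaseReg q a b c d e) (hl : l ≠ 0)
    (hlr : Reg (q ^ 2) l) (hle : Reg q (l * q / e)) :
    BaseReg q l (l * b / a) (l * c / a) (l * d / a) e := by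
  have ha := hr.a_ne
  have h : ∀ x, l * q / (l * x / a) = a * q / x := fun x => by
    rw [div_div_eq_mul_div, show l * q * a = l * (a * q) by ring, mul_div_mul_left _ _ hl]
  exact ⟨hl, div_ne_zero (mul_ne_zero hl hr.b_ne) ha, div_ne_zero (mul_ne_zero hl hr.c_ne) ha,
    div_ne_zero (mul_ne_zero hl hr.d_ne) ha, hr.e_ne, hlr, by rw [h]; exact hr.low_b,
    by rw [h]; exact hr.low_c, by rw [h]; exact hr.low_d, hle⟩

/-- Both sides satisfy the same recurrence in N: the middle coefficients agree, and `trRatio`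
carries C and D of one side to those of the other. As C never vanishes at F = q^N, the value at N =
0 and the two-term relation at F = 1 determine everything. -/
theorem wFin_transform {q a b c d e l : ℂ} (hq0 : q ≠ 0) (hq : ‖q‖ < 1)
    (hr : BaseReg q a b c d e) (ha : Reg q a) (hlam : l * (b * c * d) = q * a ^ 2)
    (hl : Reg q l) (hle : Reg q (l * q / e)) (N : ℕ) :
    wFin q a b c d e N =
      trRatio q a e l N * wFin q l (l * b / a) (l * c / a) (l * d / a) e N := by
  have ha0 := hr.a_ne
  have hb := hr.b_ne
  have hc := hr.c_ne
  have hd := hr.d_ne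
  have he := hr.e_ne
  have hl0 : l ≠ 0 := by
    rintro rfl
    rw [zero_mul] at hlam
    exact mul_ne_zero hq0 (pow_ne_zero 2 ha0) hlam.symm
  have hr' := hr.transform hl0 hl.sq hle
  have hfac : ∀ {x}, Reg q (a * q / x) → ∀ N, 1 - a * q * q ^ N / x ≠ 0 := fun hx N => by
    have := hx.one_sub_ne N; rwa [div_mul_eq_mul_div] at this
  have hk₁ : ∀ N, 1 - a * q * q ^ N ≠ 0 := ha.mul_self.one_sub_ne
  have hk₂ : ∀ N, 1 - l * q * q ^ N ≠ 0 := hl.mul_self.one_sub_ne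
  have hC0 : ∀ N, ctgC q a b c d e (q ^ N) ≠ 0 := fun N => by
    rw [ctgC]
    exact neg_ne_zero.2 (div_ne_zero (mul_ne_zero (mul_ne_zero (mul_ne_zero (hfac hr.low_b N)
      (hfac hr.low_c N)) (hfac hr.low_d N)) (hfac hr.low_e N)) (hk₁ N))
  have hsucc : ∀ N, trRatio q a e l (N + 1) = trRatio q a e l N *
      ((1 - a * q * q ^ N) * (1 - l * q * q ^ N / e) /
        ((1 - a * q * q ^ N / e) * (1 - l * q * q ^ N))) := fun N => by
    simp only [trRatio, qPoch_succ]
    rw [div_mul_div_comm, div_mul_eq_mul_div, div_mul_eq_mul_div]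
    congr 1 <;> ring
  have hCtr : ∀ N, ctgC q a b c d e (q ^ N) * trRatio q a e l (N + 1) =
      ctgC q l (l * b / a) (l * c / a) (l * d / a) e (q ^ N) * trRatio q a e l N := fun N => by
    have h1 := hk₁ N
    have h2 := hk₂ N
    have h3 := hfac hr.low_e N
    rw [hsucc, ctgC_transform hl0, ctgC]
    generalize 1 - a * q * q ^ N = k₁, 1 - l * q * q ^ N = k₂, 1 - a * q * q ^ N / e = k₃ at *
    field_simp
  have hDtr : ∀ N, ctgD q a b c d e (q ^ (N + 1)) * trRatio q a e l N =
      ctgD q l (l * b / a) (l * c / a) (l * d / a) e (q ^ (N + 1)) * trRatio q a e l (N + 1) :=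
    fun N => by
    have h2 := hk₂ N
    have h3 := hfac hr.low_e N
    rw [hsucc, ctgD, ctgD,
      show a ^ 2 * q * q ^ (N + 1) / (b * c * d * e) = l * q * q ^ N / e by
        rw [mul_div_right_comm, base_eq hb hc hd he hlam]; ring,
      show l ^ 2 * q * q ^ (N + 1) / (l * b / a * (l * c / a) * (l * d / a) * e) =
          a * q * q ^ N / e by
        rw [mul_div_right_comm, base_transform ha0 hb hc hd he hl0 hlam]; ring,
      show a * q ^ (N + 1) = a * q * q ^ N by ring, show l * q ^ (N + 1) = l * q * q ^ N by ring]
    generalize 1 - a * q * q ^ N = k₁, 1 - l * q * q ^ N = k₂, 1 - a * q * q ^ N / e = k₃ at *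
    field_simp
  have hM : ∀ N, ctgM q a b c d e (q ^ N) =
      ctgM q l (l * b / a) (l * c / a) (l * d / a) e (q ^ N) := fun N =>
    ctgM_transform ha0 hb hc hd he hl0 hlam (hk₁ N) (hk₂ N)
  induction N using Nat.twoStepInduction with
  | zero => simp [wFin_zero, trRatio, qPoch]
  | one =>
    have h1 := wFin_contiguous_zero hq0 hq hr ha
    have h2 := wFin_contiguous_zero hq0 hq hr' hl
    have h3 := hCtr 0
    have h4 := hM 0
    have h5 := hC0 0
    have h6 : trRatio q a e l 0 = 1 := by simp [trRatio, qPoch]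
    rw [wFin_zero] at h1 h2
    rw [h6] at h3
    simp only [pow_zero, zero_add] at h3 h4 h5
    rw [← mul_right_inj' h5]
    linear_combination h1 - h2 + h4 - wFin q l (l * b / a) (l * c / a) (l * d / a) e 1 * h3
  | more N ih0 ih1 =>
    have h1 := wFin_contiguous hq0 hq hr (ha.mul_pow (N + 1))
    have h2 := wFin_contiguous hq0 hq hr' (hl.mul_pow (N + 1))
    have h3 := hCtr (N + 1)
    have h4 := hM (N + 1)
    have h5 := hC0 (N + 1)
    have h6 := hDtr N
    rw [ih0, ih1] at h1
    rw [← mul_right_inj' h5]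
    linear_combination h1 - trRatio q a e l (N + 1) * h2 +
      trRatio q a e l (N + 1) * wFin q l (l * b / a) (l * c / a) (l * d / a) e (N + 1) * h4 -
      wFin q l (l * b / a) (l * c / a) (l * d / a) e (N + 2) * h3 -
      wFin q l (l * b / a) (l * c / a) (l * d / a) e N * h6

/-- The two-term transformation of nonterminating very-well-poised series. -/
theorem wSum_transform {q a b c d e l F : ℂ} (hq0 : q ≠ 0) (hq : ‖q‖ < 1)
    (hr : BaseReg q a b c d e) (ha : Reg q a) (hlam : l * (b * c * d) = q * a ^ 2)
    (hl : Reg q l) (hle : Reg q (l * q / e)) (h₁ : Reg q (a * q * F))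
    (h₂ : Reg q (l * q / e * F)) (h₃ : Reg q (l * q * F)) (h₄ : Reg q (a * q / e * F)) :
    wSum q a b c d e F * (qPochInf q (a * q / e) * qPochInf q (a * q * F) *
        (qPochInf q (l * q) * qPochInf q (l * q / e * F))) =
      qPochInf q (a * q) * qPochInf q (a * q / e * F) *
        (qPochInf q (l * q / e) * qPochInf q (l * q * F)) *
        wSum q l (l * b / a) (l * c / a) (l * d / a) e F := by
  have ha0 := hr.a_ne
  have hl0 : l ≠ 0 := by
    rintro rfl
    rw [zero_mul] at hlam
    exact mul_ne_zero hq0 (pow_ne_zero 2 ha0) hlam.symm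
  have hr' := hr.transform hl0 hl.sq hle
  have hu : a ^ 2 * q ^ 2 / (b * c * d * e) = l * q / e := by
    rw [pow_two q, ← mul_assoc, mul_div_right_comm, base_eq hr.b_ne hr.c_ne hr.d_ne hr.e_ne hlam]
    ring
  have hu' : l ^ 2 * q ^ 2 / (l * b / a * (l * c / a) * (l * d / a) * e) = a * q / e := by
    rw [pow_two q, ← mul_assoc, mul_div_right_comm,
      base_transform ha0 hr.b_ne hr.c_ne hr.d_ne hr.e_ne hl0 hlam]
    ring
  set U : Set ℂ := ({F | Reg q (a * q * F)} ∩ {F | Reg q (l * q / e * F)}) ∩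
    ({F | Reg q (l * q * F)} ∩ {F | Reg q (a * q / e * F)}) with hUdef
  have hU : IsOpen U := ((isOpen_setOf_reg_mul hq _).inter (isOpen_setOf_reg_mul hq _)).inter
    ((isOpen_setOf_reg_mul hq _).inter (isOpen_setOf_reg_mul hq _))
  have hw := differentiableOn_wSum hq0 hq hr 1 hU (fun F h => by rw [mul_one, hu]; exact h.1.2)
    (fun F h => by rw [mul_one]; exact h.1.1)
  have hw' := differentiableOn_wSum hq0 hq hr' 1 hU
    (fun F h => by rw [mul_one, hu']; exact h.2.2) (fun F h => by rw [mul_one]; exact h.2.1)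
  simp only [mul_one] at hw hw'
  have hI : ∀ x : ℂ, DifferentiableOn ℂ (fun F => qPochInf q (x * F)) U := fun x =>
    ((differentiable_qPochInf hq).comp (by fun_prop : Differentiable ℂ fun F => x * F)).differentiableOn
  -- With the infinite products cleared from denominators both sides are holomorphic. At F = q^N the
  -- splitting (x)_∞ = (x)_N (xq^N)_∞ reduces the claim to the terminating case.
  refine eqOn_of_eq_pow hq0 hq (f := fun F => wSum q a b c d e F * (qPochInf q (a * q / e) *
      qPochInf q (a * q * F) * (qPochInf q (l * q) * qPochInf q (l * q / e * F))))
    (g := fun F => qPochInf q (a * q) * qPochInf q (a * q / e * F) *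
        (qPochInf q (l * q / e) * qPochInf q (l * q * F)) *
        wSum q l (l * b / a) (l * c / a) (l * d / a) e F) hU ?_
    ⟨⟨reg_zero_mem q _, reg_zero_mem q _⟩, reg_zero_mem q _, reg_zero_mem q _⟩ ?_ ?_ ?_
    (⟨⟨h₁, h₂⟩, h₃, h₄⟩ : F ∈ U)
  · simp only [hUdef, Set.compl_inter]
    exact ((countable_compl_reg_mul q _).union (countable_compl_reg_mul q _)).union
      ((countable_compl_reg_mul q _).union (countable_compl_reg_mul q _))
  · exact hw.fun_mul (((hI _).const_mul _).fun_mul ((hI _).const_mul _))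
  · exact (((hI _).const_mul _).fun_mul ((hI _).const_mul _)).fun_mul hw'
  · filter_upwards [wSum_eq_wFin hq0 hq hr, wSum_eq_wFin hq0 hq hr'] with N hN hN'
    rw [hN, hN', wFin_transform hq0 hq hr ha hlam hl hle, trRatio,
      qPochInf_eq_qPoch_mul hq (a * q / e) N, qPochInf_eq_qPoch_mul hq (l * q) N,
      qPochInf_eq_qPoch_mul hq (a * q) N, qPochInf_eq_qPoch_mul hq (l * q / e) N]
    have n1 := hr.low_e.qPoch_ne_zero N
    have n2 := hl.mul_self.qPoch_ne_zero N
    generalize qPoch q (a * q / e) N = p₁, qPoch q (l * q) N = p₂ at *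
    field_simp

/-! ### Symmetry in the parameters and the value at F = 0. -/

lemma vwpNum_inv {q u a b c d e f : ℂ} (hf : f ≠ 0) :
    vwpNum q (u * f⁻¹) u a b c d e = .C (u * f⁻¹) * ((.C 1 - .C a * .X) *
      (.C 1 - .C (a * q ^ 2) * .X ^ 2) * ((.C 1 - .C b * .X) * (.C 1 - .C c * .X) *
        (.C 1 - .C d * .X) * (.C 1 - .C e * .X) * (.C 1 - .C f * .X))) := by
  have h : (.C (u * f⁻¹) - .C u * .X : Polynomial ℂ) = .C (u * f⁻¹) * (.C 1 - .C f * .X) := by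
    rw [mul_sub, ← mul_assoc, ← Polynomial.C_mul, ← Polynomial.C_mul, mul_one,
      inv_mul_cancel_right₀ hf]
  rw [vwpNum, h]; ring

/-- At F = 1/f the factor z - yX equals z(1 - fX), so f stands on the same footing as b, c, d, e. -/
lemma wSum_rotate {q a b c d e f : ℂ} (he : e ≠ 0) (hf : f ≠ 0) :
    wSum q a b c d e f⁻¹ = wSum q a f b c d e⁻¹ := by
  have hz : a ^ 2 * q ^ 2 / (f * b * c * d) * e⁻¹ = a ^ 2 * q ^ 2 / (b * c * d * e) * f⁻¹ := by
    rw [← div_eq_mul_inv, ← div_eq_mul_inv, div_div, div_div]; ring_nf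
  have h1 : vwpDen q a (a * q / f) (a * q / b) (a * q / c) (a * q / d) (a * q * e⁻¹) =
      vwpDen q a (a * q / b) (a * q / c) (a * q / d) (a * q / e) (a * q * f⁻¹) := by
    rw [← div_eq_mul_inv, ← div_eq_mul_inv, vwpDen, vwpDen]; ring
  rw [wSum, wSum, vwpSum, vwpSum, h1, vwpNum_inv hf, vwpNum_inv he, hz]
  refine congrArg (fun P => contVal q 8 P _) ?_
  ring

lemma W87_eq_wSum {q : ℂ} (hq0 : q ≠ 0) (hq : ‖q‖ < 1) {a b c d e f z : ℂ}
    (hr : BaseReg q a b c d e) (hf : f ≠ 0) (hfr : Reg q (a * q / f)) (hzr : Reg q z)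
    (hz : z = a ^ 2 * q ^ 2 / (b * c * d * e * f)) :
    W87 q a b c d e f z = wSum q a b c d e f⁻¹ := by
  rw [W87_eq_vwpSum hq0 hq ⟨hzr, hr.base, hr.low_b, hr.low_c, hr.low_d, hr.low_e, hfr⟩, wSum]
  have h : z = a ^ 2 * q ^ 2 / (b * c * d * e) * f⁻¹ := by
    rw [hz, ← div_eq_mul_inv, div_div]
  rw [← h, ← div_eq_mul_inv (a * q), show a ^ 2 * q ^ 2 / (b * c * d * e) = z * f by
    rw [h, inv_mul_cancel_right₀ hf]]

lemma vwpSum_phi {q z f b c g₁ g₂ : ℂ} :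
    vwpSum q z (z * c) 0 f 0 0 b 0 g₁ g₂ 0 0 = vwpSum q z (z * f) 0 b c 0 0 g₁ g₂ 0 0 0 := by
  rw [vwpSum, vwpSum]
  refine congrArg₂ (contVal q 8) ?_ ?_
  · simp only [vwpNum, Polynomial.C_mul, Polynomial.C_0, Polynomial.C_1]; ring
  · simp only [vwpDen]; ring

/-- The value at `F = 0`, for generic `a`. -/
lemma wSum_zero_generic {q a b c d e : ℂ} (hq0 : q ≠ 0) (hq : ‖q‖ < 1)
    (hr : BaseReg q a b c d e) (ha : Reg q a) (hde : Reg q (a * q / (d * e))) :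
    wSum q a b c d e 0 * (qPochInf q (a * q / d) * qPochInf q (a * q / e)) =
      qPochInf q (a * q) * qPochInf q (a * q / (d * e)) *
        phi q [a * q / (b * c), d, e] [a * q / b, a * q / c] (a * q / (d * e)) := by
  have ha0 := hr.a_ne
  have hb0 := hr.b_ne
  have hc0 := hr.c_ne
  have hd0 := hr.d_ne
  have he0 := hr.e_ne
  set v := q * a ^ 2 / (b * c) with hv
  set U : Set ℂ := (({B | Reg q (a * q * B)} ∩ {B | Reg q (v * q / (d * e) * B)}) ∩
    ({B | Reg q (v * B)} ∩ {B | Reg q (v * q / d * B)})) ∩ {B | Reg q (v * q / e * B)} with hUdef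
  have hU : IsOpen U := (((isOpen_setOf_reg_mul hq _).inter (isOpen_setOf_reg_mul hq _)).inter
    ((isOpen_setOf_reg_mul hq _).inter (isOpen_setOf_reg_mul hq _))).inter
    (isOpen_setOf_reg_mul hq _)
  have h0U : (0 : ℂ) ∈ U := ⟨⟨⟨reg_zero_mem q _, reg_zero_mem q _⟩, reg_zero_mem q _,
    reg_zero_mem q _⟩, reg_zero_mem q _⟩
  have hw := differentiableOn_wSum hq0 hq hr 1 hU (fun B h => by
    have := h.1.1.2
    rw [mul_one, show a ^ 2 * q ^ 2 / (b * c * d * e) = v * q / (d * e) by rw [hv]; field_simp]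
    exact this) (fun B h => by rw [mul_one]; exact h.1.1.1)
  simp only [mul_one] at hw
  have hR : DifferentiableOn ℂ (fun B => vwpSum q (a * q / (d * e)) (a * q / (d * e) * e) (v * B)
      (a * q / (b * c)) (a * q / c * B) (a * q / b * B) d (a * q * B) (a * q / b) (a * q / c)
      (v * q / d * B) (v * q / e * B)) U := by
    refine differentiableOn_vwpSum hq0 hq hU ?_ ?_ ?_ ?_ ?_ ?_ ?_ ?_ ?_ ?_ ?_ ?_
      fun B h => ⟨hde, Reg.sq h.1.2.1, h.1.1.1, hr.low_b, hr.low_c, h.1.2.2, h.2⟩ <;> fun_prop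
  have hI : ∀ x : ℂ, DifferentiableOn ℂ (fun B => qPochInf q (x * B)) U := fun x =>
    ((differentiable_qPochInf hq).comp
      (by fun_prop : Differentiable ℂ fun F => x * F)).differentiableOn
  -- For B ≠ 0 this is the two-term transformation acting on the parameters 1/B, b, c, with new base
  -- vB. Both sides extend continuously to B = 0, where the new base vanishes and the right side
  -- collapses to the ₃φ₂.
  have key := eqOn_of_countable (S := {0}ᶜ) (f := fun B => wSum q a b c d e B *
      (qPochInf q (a * q / d) * qPochInf q (a * q / e) * (qPochInf q (v * q * B) *
        qPochInf q (v * q / (d * e) * B))))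
    (g := fun B => qPochInf q (a * q) * qPochInf q (a * q / (d * e)) *
      (qPochInf q (v * q / d * B) * qPochInf q (v * q / e * B)) *
      vwpSum q (a * q / (d * e)) (a * q / (d * e) * e) (v * B) (a * q / (b * c)) (a * q / c * B)
        (a * q / b * B) d (a * q * B) (a * q / b) (a * q / c) (v * q / d * B) (v * q / e * B))
    hU (by simp) (hw.fun_mul (((hI _).fun_mul (hI _)).const_mul _)).continuousOn
    ((((hI _).fun_mul (hI _)).const_mul _).fun_mul hR).continuousOn ?_ h0U
  · have h1 : qPochInf q 0 = 1 := by simp [qPochInf]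
    simp only [mul_zero, h1, mul_one] at key
    rw [key, vwpSum_phi, phi32_eq_vwpSum hq0 hq hde hr.low_b hr.low_c]
  · intro B hB hB0
    have hB0 : B ≠ 0 := hB0
    have hr1 : BaseReg q a B⁻¹ b c d := ⟨ha0, inv_ne_zero hB0, hb0, hc0, hd0, hr.base,
      by rw [div_inv_eq_mul]; exact hB.1.1.1, hr.low_b, hr.low_c, hr.low_d⟩
    have e1 : v * B * q / d = v * q / d * B := by ring
    have e2 : v * B * q * e⁻¹ = v * q / e * B := by ring
    have e3 : v * B * q / d * e⁻¹ = v * q / (d * e) * B := by field_simp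
    have e4 : a * q / d * e⁻¹ = a * q / (d * e) := by field_simp
    have e5 : a * q * e⁻¹ = a * q / e := by ring
    have hT := wSum_transform (F := e⁻¹) hq0 hq hr1 ha (l := v * B) (by rw [hv]; field_simp)
      hB.1.2.1 (by rw [e1]; exact hB.1.2.2) (by rw [e5]; exact hr.low_e)
      (by rw [e3]; exact hB.1.1.2) (by rw [e2]; exact hB.2) (by rw [e4]; exact hde)
    have h3 : wSum q (v * B) (v * B * B⁻¹ / a) (v * B * b / a) (v * B * c / a) d e⁻¹ =
        vwpSum q (a * q / (d * e)) (a * q / (d * e) * e) (v * B) (a * q / (b * c)) (a * q / c * B)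
          (a * q / b * B) d (a * q * B) (a * q / b) (a * q / c) (v * q / d * B)
          (v * q / e * B) := by
      rw [wSum, e1, e2]
      congr 1 <;> (rw [hv]; field_simp)
    rw [h3, e3, e1, e2, e4, e5] at hT
    have h4 := wSum_rotate (q := q) (a := a) (b := b) (c := c) (d := d) he0 (inv_ne_zero hB0)
    rw [inv_inv] at h4
    rw [h4, show v * q * B = v * B * q by ring]
    exact hT

lemma isOpen_reg_comp {q : ℂ} (hq : ‖q‖ < 1) {f : ℂ → ℂ} (hf : Continuous f) :
    IsOpen {s | Reg q (f s)} := (isOpen_setOf_reg hq).preimage hf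

/-- The value at `F = 0`. -/
theorem wSum_zero {q a b c d e : ℂ} (hq0 : q ≠ 0) (hq : ‖q‖ < 1)
    (hr : BaseReg q a b c d e) (hde : Reg q (a * q / (d * e))) :
    wSum q a b c d e 0 * (qPochInf q (a * q / d) * qPochInf q (a * q / e)) =
      qPochInf q (a * q) * qPochInf q (a * q / (d * e)) *
        phi q [a * q / (b * c), d, e] [a * q / b, a * q / c] (a * q / (d * e)) := by
  have hq2 : ‖q ^ 2‖ < 1 := by rw [norm_pow]; exact pow_lt_one₀ (norm_nonneg _) hq two_ne_zero
  set U : Set ℂ := {t | t ≠ 0} ∩ {t | Reg (q ^ 2) t} ∩ {t | Reg q (t * q / b)} ∩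
    {t | Reg q (t * q / c)} ∩ {t | Reg q (t * q / d)} ∩ {t | Reg q (t * q / e)} ∩
    {t | Reg q (t * q / (d * e))} with hUdef
  have hU : IsOpen U := by
    refine (((((IsOpen.inter ?_ ?_).inter ?_).inter ?_).inter ?_).inter ?_).inter ?_
    · exact isOpen_ne
    · exact isOpen_setOf_reg hq2
    all_goals exact isOpen_reg_comp hq (by fun_prop)
  have hb : ∀ t ∈ U, BaseReg q t b c d e := fun t h =>
    ⟨h.1.1.1.1.1.1, hr.b_ne, hr.c_ne, hr.d_ne, hr.e_ne, h.1.1.1.1.1.2, h.1.1.1.1.2, h.1.1.1.2,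
      h.1.1.2, h.1.2⟩
  have hI : ∀ f : ℂ → ℂ, Differentiable ℂ f → DifferentiableOn ℂ (fun t => qPochInf q (f t)) U :=
    fun f hf => ((differentiable_qPochInf hq).comp hf).differentiableOn
  have hw : DifferentiableOn ℂ (fun t => wSum q t b c d e 0) U := by
    unfold wSum
    refine differentiableOn_vwpSum hq0 hq hU ?_ ?_ ?_ ?_ ?_ ?_ ?_ ?_ ?_ ?_ ?_ ?_
      fun t h => (hb t h).vwpReg (by simpa using reg_zero q) (by simpa using reg_zero q) <;>
      fun_prop
  have hR : DifferentiableOn ℂ (fun t => vwpSum q (t * q / (d * e))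
      (t * q / (d * e) * (t * q / (b * c))) 0 d e 0 0 (t * q / b) (t * q / c) 0 0 0) U := by
    refine differentiableOn_vwpSum hq0 hq hU ?_ ?_ ?_ ?_ ?_ ?_ ?_ ?_ ?_ ?_ ?_ ?_
      fun t h => ⟨h.2, reg_zero _, (hb t h).low_b, (hb t h).low_c, reg_zero _, reg_zero _,
        reg_zero _⟩ <;> fun_prop
  -- The extra condition `Reg q t` fails for only countably many bases t; continuity in the base
  -- recovers them.
  have key := eqOn_of_countable (S := {t | Reg q (1 * t)}) (f := fun t => wSum q t b c d e 0 *
      (qPochInf q (t * q / d) * qPochInf q (t * q / e)))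
    (g := fun t => qPochInf q (t * q) * qPochInf q (t * q / (d * e)) *
      vwpSum q (t * q / (d * e)) (t * q / (d * e) * (t * q / (b * c))) 0 d e 0 0
        (t * q / b) (t * q / c) 0 0 0) hU (countable_compl_reg_mul q 1)
    (hw.fun_mul ((hI _ (by fun_prop)).fun_mul (hI _ (by fun_prop)))).continuousOn
    (((hI _ (by fun_prop)).fun_mul (hI _ (by fun_prop))).fun_mul hR).continuousOn ?_
    (⟨⟨⟨⟨⟨⟨hr.a_ne, hr.base⟩, hr.low_b⟩, hr.low_c⟩, hr.low_d⟩, hr.low_e⟩, hde⟩ : a ∈ U)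
  · rw [phi32_eq_vwpSum hq0 hq hde hr.low_b hr.low_c]
    exact key
  · intro t ht hts
    have ht' := hb t ht
    have := wSum_zero_generic hq0 hq ht' (by simpa using hts) ht.2
    rwa [phi32_eq_vwpSum hq0 hq ht.2 ht'.low_b ht'.low_c] at this

/-! ### The iterated transformation. -/

/-- The iterated transformation, for generic parameters. -/
lemma wSum_transform₂_generic {q a b c d e f z m : ℂ} (hq0 : q ≠ 0) (hq : ‖q‖ < 1)
    (hr : BaseReg q a b c d e) (hf : f ≠ 0) (hz : z = a ^ 2 * q ^ 2 / (b * c * d * e * f))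
    (hm : m = a * z / b) (hfr : Reg q (a * q / f)) (hzr : Reg q z) (hcz : Reg q (c * z))
    (hdz : Reg q (d * z)) (hez : Reg q (e * z)) (hfz : Reg q (f * z)) (hbr : Reg q b)
    (ha : Reg q a) (hmr : Reg q m) (hl : Reg q (q * a ^ 2 / (b * c * d)))
    (hef : Reg q (a * q / (e * f))) :
    wSum q a b c d e f⁻¹ * (qPochInf q (a * q / c) * qPochInf q (a * q / d) *
        (qPochInf q (a * q / e) * qPochInf q (a * q / f)) *
        (qPochInf q (m * q) * qPochInf q z)) =
      qPochInf q (a * q) * qPochInf q b * (qPochInf q (c * z) * qPochInf q (d * z) *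
        (qPochInf q (e * z) * qPochInf q (f * z))) *
      wSum q m (a * q / (b * d)) (a * q / (b * c)) (a * q / (b * f)) (a * q / (b * e)) z⁻¹ := by
  have ha0 := hr.a_ne
  have hb0 := hr.b_ne
  have hc0 := hr.c_ne
  have hd0 := hr.d_ne
  have he0 := hr.e_ne
  obtain ⟨l, hldef⟩ : ∃ l, l = q * a ^ 2 / (b * c * d) := ⟨_, rfl⟩
  rw [← hldef] at hl
  have hl0 : l ≠ 0 := by rw [hldef]; positivity
  have hz0 : z ≠ 0 := by rw [hz]; positivity
  have i1 : l * q / e = f * z := by rw [hldef, hz]; field_simp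
  have i2 : l * q / f = e * z := by rw [hldef, hz]; field_simp
  have i3 : l * q / e * f⁻¹ = z := by rw [hldef, hz]; field_simp
  have i4 : l * q * f⁻¹ = e * z := by rw [← i2, div_eq_mul_inv]
  have i5 : a * q / e * f⁻¹ = a * q / (e * f) := by field_simp
  have i6 : a * q * f⁻¹ = a * q / f := by field_simp
  have i7 : ∀ x, l * q / (l * x / a) = a * q / x := fun x => by
    rw [div_div_eq_mul_div, show l * q * a = l * (a * q) by ring, mul_div_mul_left _ _ hl0]
  have T1 := wSum_transform (F := f⁻¹) hq0 hq hr ha (l := l) (by rw [hldef]; field_simp) hl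
    (by rw [i1]; exact hfz) (by rw [i6]; exact hfr) (by rw [i3]; exact hzr)
    (by rw [i4]; exact hez) (by rw [i5]; exact hef)
  -- The parameters are reordered so that the second application acts on e, f, lb/a, with ld/a in
  -- the role of 1/F; it changes the base from l to m.
  have hr2 : BaseReg q l e f (l * b / a) (l * c / a) := ⟨hl0, he0, hf, by positivity,
    by positivity, hl.sq, by rw [i1]; exact hfz, by rw [i2]; exact hez,
    by rw [i7]; exact hr.low_b, by rw [i7]; exact hr.low_c⟩
  have j1 : m * q / (l * c / a) = d * z := by rw [hm, hldef]; field_simp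
  have j2 : l * q * (l * d / a)⁻¹ = a * q / d := by
    rw [← i7 d]; exact (div_eq_mul_inv _ _).symm
  have j3 : m * q / (l * c / a) * (l * d / a)⁻¹ = a * q / (e * f) := by
    rw [j1, hz, hldef]; field_simp
  have j4 : m * q * (l * d / a)⁻¹ = c * z := by rw [hm, hldef]; field_simp
  have j5 : l * q / (l * c / a) * (l * d / a)⁻¹ = b := by rw [i7, hldef]; field_simp
  have T2 := wSum_transform (F := (l * d / a)⁻¹) hq0 hq hr2 hl (l := m)
    (by rw [hm, hz, hldef]; field_simp) hmr (by rw [j1]; exact hdz)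
    (by rw [j2]; exact hr.low_d) (by rw [j3]; exact hef) (by rw [j4]; exact hcz)
    (by rw [j5]; exact hbr)
  have k1 : m * (l * b / a) / l = z := by rw [hm]; field_simp
  have k2 : m * e / l = a * q / (b * f) := by rw [hm, hz, hldef]; field_simp
  have k3 : m * f / l = a * q / (b * e) := by rw [hm, hz, hldef]; field_simp
  have k4 : l * c / a = a * q / (b * d) := by rw [hldef]; field_simp
  have k5 : l * d / a = a * q / (b * c) := by rw [hldef]; field_simp
  have hB : l * b / a ≠ 0 := by positivity
  have hC : l * c / a ≠ 0 := by positivity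
  have hD : l * d / a ≠ 0 := by positivity
  rw [i3, i1, i4, i5, i6, wSum_rotate (a := l) he0 hf, wSum_rotate (a := l) hD he0] at T1
  rw [j5, j3, j1, j4, j2, i7 c, k1, k2, k3, wSum_rotate (a := m) hC hD,
    wSum_rotate (a := m) hz0 hC] at T2
  -- The factors (lq)_∞ and (aq/(ef))_∞ belong to the intermediate base and cancel between the two
  -- applications.
  have n1 := qPochInf_ne_zero hq hl.mul_self
  have n2 := qPochInf_ne_zero hq hef
  rw [← k4, ← k5, ← mul_right_inj' (mul_ne_zero n1 n2)]
  linear_combination (qPochInf q (a * q / c) * qPochInf q (a * q / d) * qPochInf q (m * q) *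
      qPochInf q (a * q / (e * f))) * T1 +
    (qPochInf q (a * q) * qPochInf q (a * q / (e * f)) * (qPochInf q (f * z) *
      qPochInf q (e * z))) * T2

/-- The iterated transformation. -/
theorem wSum_transform₂ {q a b c d e f z m : ℂ} (hq0 : q ≠ 0) (hq : ‖q‖ < 1)
    (hr : BaseReg q a b c d e) (hf : f ≠ 0) (hz : z = a ^ 2 * q ^ 2 / (b * c * d * e * f))
    (hm : m = a * z / b) (hfr : Reg q (a * q / f)) (hzr : Reg q z) (hcz : Reg q (c * z))
    (hdz : Reg q (d * z)) (hez : Reg q (e * z)) (hfz : Reg q (f * z)) (hbr : Reg q b)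
    (hmr : Reg (q ^ 2) m) :
    wSum q a b c d e f⁻¹ * (qPochInf q (a * q / c) * qPochInf q (a * q / d) *
        (qPochInf q (a * q / e) * qPochInf q (a * q / f)) *
        (qPochInf q (m * q) * qPochInf q z)) =
      qPochInf q (a * q) * qPochInf q b * (qPochInf q (c * z) * qPochInf q (d * z) *
        (qPochInf q (e * z) * qPochInf q (f * z))) *
      wSum q m (a * q / (b * d)) (a * q / (b * c)) (a * q / (b * f)) (a * q / (b * e)) z⁻¹ := by
  have ha0 := hr.a_ne
  have hb0 := hr.b_ne
  have hc0 := hr.c_ne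
  have hd0 := hr.d_ne
  have he0 := hr.e_ne
  have hq2 : ‖q ^ 2‖ < 1 := by rw [norm_pow]; exact pow_lt_one₀ (norm_nonneg _) hq two_ne_zero
  have hz0 : z ≠ 0 := by rw [hz]; positivity
  have hm0 : m ≠ 0 := by rw [hm]; positivity
  -- Scaling a and b by s scales z, m, l and aq/(ef) by s. The generic conditions then fail for only
  -- countably many s, and continuity gives s = 1.
  set U : Set ℂ := {s | s ≠ 0} ∩ {s | Reg (q ^ 2) (a * s)} ∩ {s | Reg (q ^ 2) (m * s)} ∩
    {s | Reg q (a * q / c * s)} ∩ {s | Reg q (a * q / d * s)} ∩ {s | Reg q (a * q / e * s)} ∩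
    {s | Reg q (a * q / f * s)} ∩ {s | Reg q (z * s)} ∩ {s | Reg q (c * z * s)} ∩
    {s | Reg q (d * z * s)} ∩ {s | Reg q (e * z * s)} ∩ {s | Reg q (f * z * s)} ∩
    {s | Reg q (b * s)} with hUdef
  have hU : IsOpen U := by
    refine (((((((((((IsOpen.inter ?_ ?_).inter ?_).inter ?_).inter ?_).inter ?_).inter ?_).inter
      ?_).inter ?_).inter ?_).inter ?_).inter ?_).inter ?_
    · exact isOpen_ne
    · exact isOpen_setOf_reg_mul hq2 _
    · exact isOpen_setOf_reg_mul hq2 _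
    all_goals exact isOpen_setOf_reg_mul hq _
  have h1U : (1 : ℂ) ∈ U := by
    simp only [hUdef, Set.mem_inter_iff, Set.mem_ofPred_eq, mul_one]
    exact ⟨⟨⟨⟨⟨⟨⟨⟨⟨⟨⟨⟨one_ne_zero, hr.base⟩, hmr⟩, hr.low_c⟩, hr.low_d⟩, hr.low_e⟩, hfr⟩, hzr⟩,
      hcz⟩, hdz⟩, hez⟩, hfz⟩, hbr⟩
  have hI : ∀ x : ℂ, DifferentiableOn ℂ (fun s => qPochInf q (x * s)) U := fun x =>
    ((differentiable_qPochInf hq).comp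
      (by fun_prop : Differentiable ℂ fun F => x * F)).differentiableOn
  have e0 : ∀ x s : ℂ, a * s * q / x = a * q / x * s := fun x s => by ring
  have e1 : ∀ s, s ≠ 0 → a * s * q / (b * s) = a * q / b := fun s hs => by field_simp
  have e2 : ∀ x s, s ≠ 0 → a * s * q / (b * s * x) = a * q / (b * x) := fun x s hs => by
    rw [show b * s * x = b * x * s by ring, show a * s * q = a * q * s by ring,
      mul_div_mul_right _ _ hs]
  have e3 : ∀ s, s ≠ 0 → (a * s) ^ 2 * q ^ 2 / (b * s * c * d * e * f) = z * s := fun s hs => by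
    rw [hz]; field_simp
  have hbase : ∀ s ∈ U, BaseReg q (a * s) (b * s) c d e := fun s h => by
    obtain ⟨⟨⟨⟨⟨⟨⟨⟨⟨⟨⟨⟨h0, h1⟩, h2⟩, h3⟩, h4⟩, h5⟩, h6⟩, h7⟩, h8⟩, h9⟩, h10⟩, h11⟩, h12⟩ := h
    have h0 : s ≠ 0 := h0
    exact ⟨mul_ne_zero ha0 h0, mul_ne_zero hb0 h0, hc0, hd0, he0, h1,
      by rw [e1 s h0]; exact hr.low_b, by rw [e0]; exact h3, by rw [e0]; exact h4,
      by rw [e0]; exact h5⟩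
  have hL : DifferentiableOn ℂ (fun s => vwpSum q (z * s) (z * f * s) (a * s) (b * s) c d e
      (a * q / b) (a * q / c * s) (a * q / d * s) (a * q / e * s) (a * q / f * s)) U := by
    refine differentiableOn_vwpSum hq0 hq hU ?_ ?_ ?_ ?_ ?_ ?_ ?_ ?_ ?_ ?_ ?_ ?_
      fun s h => ?_
    rotate_right
    · obtain ⟨⟨⟨⟨⟨⟨⟨⟨⟨⟨⟨⟨h0, h1⟩, h2⟩, h3⟩, h4⟩, h5⟩, h6⟩, h7⟩, h8⟩, h9⟩, h10⟩, h11⟩, h12⟩ := h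
      exact ⟨h7, h1, hr.low_b, h3, h4, h5, h6⟩
    all_goals fun_prop
  have hR : DifferentiableOn ℂ (fun s => vwpSum q (b * s) (b * z * s * s) (m * s)
      (a * q / (b * d)) (a * q / (b * c)) (a * q / (b * f)) (a * q / (b * e))
      (d * z * s) (c * z * s) (f * z * s) (e * z * s) (a * q / b)) U := by
    refine differentiableOn_vwpSum hq0 hq hU ?_ ?_ ?_ ?_ ?_ ?_ ?_ ?_ ?_ ?_ ?_ ?_
      fun s h => ?_
    rotate_right
    · obtain ⟨⟨⟨⟨⟨⟨⟨⟨⟨⟨⟨⟨h0, h1⟩, h2⟩, h3⟩, h4⟩, h5⟩, h6⟩, h7⟩, h8⟩, h9⟩, h10⟩, h11⟩, h12⟩ := h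
      exact ⟨h12, h2, h9, h8, h11, h10, hr.low_b⟩
    all_goals fun_prop
  have hLeq : ∀ s, s ≠ 0 → vwpSum q (z * s) (z * f * s) (a * s) (b * s) c d e
      (a * q / b) (a * q / c * s) (a * q / d * s) (a * q / e * s) (a * q / f * s) =
      wSum q (a * s) (b * s) c d e f⁻¹ := fun s hs => by
    rw [wSum, e1 s hs, e0, e0, e0]
    congr 1 <;> first | (rw [hz]; field_simp) | field_simp
  have hReq : ∀ s, s ≠ 0 → vwpSum q (b * s) (b * z * s * s) (m * s)
      (a * q / (b * d)) (a * q / (b * c)) (a * q / (b * f)) (a * q / (b * e))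
      (d * z * s) (c * z * s) (f * z * s) (e * z * s) (a * q / b) =
      wSum q (m * s) (a * q / (b * d)) (a * q / (b * c)) (a * q / (b * f)) (a * q / (b * e))
        (z * s)⁻¹ := fun s hs => by
    rw [wSum]
    congr 1 <;> (rw [hm, hz]; field_simp)
  have key := eqOn_of_countable
    (S := ({s | Reg q (a * s)} ∩ {s | Reg q (m * s)}) ∩
      ({s | Reg q (q * a ^ 2 / (b * c * d) * s)} ∩ {s | Reg q (a * q / (e * f) * s)}))
    (f := fun s => vwpSum q (z * s) (z * f * s) (a * s) (b * s) c d e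
      (a * q / b) (a * q / c * s) (a * q / d * s) (a * q / e * s) (a * q / f * s) *
      (qPochInf q (a * q / c * s) * qPochInf q (a * q / d * s) *
        (qPochInf q (a * q / e * s) * qPochInf q (a * q / f * s)) *
        (qPochInf q (m * q * s) * qPochInf q (z * s))))
    (g := fun s => qPochInf q (a * q * s) * qPochInf q (b * s) *
      (qPochInf q (c * z * s) * qPochInf q (d * z * s) *
        (qPochInf q (e * z * s) * qPochInf q (f * z * s))) *
      vwpSum q (b * s) (b * z * s * s) (m * s)
      (a * q / (b * d)) (a * q / (b * c)) (a * q / (b * f)) (a * q / (b * e))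
      (d * z * s) (c * z * s) (f * z * s) (e * z * s) (a * q / b)) hU ?_
    (hL.fun_mul ((((hI _).fun_mul (hI _)).fun_mul ((hI _).fun_mul (hI _))).fun_mul
      ((hI _).fun_mul (hI _)))).continuousOn
    ((((hI _).fun_mul (hI _)).fun_mul (((hI _).fun_mul (hI _)).fun_mul
      ((hI _).fun_mul (hI _)))).fun_mul hR).continuousOn ?_ h1U
  · have hL1 := hLeq 1 one_ne_zero
    have hR1 := hReq 1 one_ne_zero
    simp only [mul_one] at key hL1 hR1
    rw [hL1, hR1] at key
    exact key
  · simp only [Set.compl_inter]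
    exact ((countable_compl_reg_mul q _).union (countable_compl_reg_mul q _)).union
      ((countable_compl_reg_mul q _).union (countable_compl_reg_mul q _))
  · intro s hs hsS
    have hb' := hbase s hs
    obtain ⟨⟨⟨⟨⟨⟨⟨⟨⟨⟨⟨⟨h0, h1⟩, h2⟩, h3⟩, h4⟩, h5⟩, h6⟩, h7⟩, h8⟩, h9⟩, h10⟩, h11⟩, h12⟩ := hs
    have h0 : s ≠ 0 := h0
    have hT := wSum_transform₂_generic (z := z * s) (m := m * s) hq0 hq hb' hf (e3 s h0).symm
      (by rw [hm]; field_simp) (by rw [e0]; exact h6) h7 (by rw [← mul_assoc]; exact h8)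
      (by rw [← mul_assoc]; exact h9) (by rw [← mul_assoc]; exact h10)
      (by rw [← mul_assoc]; exact h11) h12 hsS.1.1 hsS.1.2
      (by rw [show q * (a * s) ^ 2 / (b * s * c * d) = q * a ^ 2 / (b * c * d) * s by field_simp]
          exact hsS.2.1) (by rw [e0]; exact hsS.2.2)
    simp only [e2 _ s h0, e0 c, e0 d, e0 e, e0 f, ← mul_assoc c z s, ← mul_assoc d z s, ← mul_assoc e z s,
      ← mul_assoc f z s] at hT
    rw [hLeq s h0, hReq s h0, show m * q * s = m * s * q by ring,
      show a * q * s = a * s * q by ring]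
    exact hT

/-! ### Minimal solutions and Pincherle's theorem. -/

lemma SolvesRec.ext {γ δ X Y : ℕ → ℂ} (hX : SolvesRec γ δ X) (hY : SolvesRec γ δ Y)
    (h0 : X 0 = Y 0) (h1 : X 1 = Y 1) (n : ℕ) : X n = Y n := by
  induction n using Nat.twoStepInduction with
  | zero => exact h0
  | one => exact h1
  | more n ih0 ih1 =>
    have hx := hX n
    have hy := hY n
    rw [ih0, ih1] at hx
    linear_combination hx - hy

lemma SolvesRec.comb {γ δ X Y : ℕ → ℂ} (hX : SolvesRec γ δ X) (hY : SolvesRec γ δ Y) (s t : ℂ) :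
    SolvesRec γ δ fun n => s * X n + t * Y n := fun n => by
  linear_combination s * hX n + t * hY n

/-- A nonzero solution with `(-1)^n Y n → 0` is minimal if there is a solution `X` for which
`(-1)^n X n` has a nonzero limit. -/
lemma isMinimalSolution_of_tendsto {γ δ X Y : ℕ → ℂ} {L : ℂ} (hX : SolvesRec γ δ X)
    (hY : SolvesRec γ δ Y) (hL : L ≠ 0) (hXL : Tendsto (fun n => (-1) ^ n * X n) atTop (𝓝 L))
    (hY0 : Tendsto (fun n => (-1) ^ n * Y n) atTop (𝓝 0)) (hne : ∃ n, Y n ≠ 0) :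
    IsMinimalSolution γ δ Y := by
  have hnot : ∀ t : ℂ, ¬ ∀ n, X n = t * Y n := fun t ht => hL <| by
    refine tendsto_nhds_unique hXL ?_
    have := hY0.const_mul t
    rw [mul_zero] at this
    refine this.congr fun n => ?_
    rw [ht n]; ring
  -- The Casoratian at index 0. If it vanished, X would be a multiple of Y; only forward recursion
  -- is used, so zeros of δ do not matter.
  have hW : X 0 * Y 1 - X 1 * Y 0 ≠ 0 := fun hW => by
    by_cases h : Y 0 = 0
    · by_cases h1 : Y 1 = 0
      · obtain ⟨n, hn⟩ := hne
        have := SolvesRec.ext (Y := fun _ => 0) hY (fun n => by simp) h h1 n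
        exact hn this
      · refine hnot (X 1 / Y 1) fun n => ?_
        have h2 := SolvesRec.ext hX (hY.comb hY (X 1 / Y 1) 0) (n := n)
        simp only [h, mul_zero, zero_mul, add_zero] at h2
        refine h2 ?_ (by field_simp)
        rw [h, mul_zero, sub_zero] at hW
        exact (mul_eq_zero.1 hW).resolve_right h1
    · refine hnot (X 0 / Y 0) fun n => ?_
      have h2 := SolvesRec.ext hX (hY.comb hY (X 0 / Y 0) 0) (n := n)
      simp only [zero_mul, add_zero] at h2
      refine h2 (by field_simp) ?_
      field_simp
      linear_combination -hW
  refine ⟨hY, hne, fun Z hZ hZn => ?_⟩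
  set W := X 0 * Y 1 - X 1 * Y 0 with hWdef
  -- Cramer's rule on the two initial values.
  have hZeq : ∀ n, Z n = (Z 0 * Y 1 - Z 1 * Y 0) / W * X n +
      (X 0 * Z 1 - X 1 * Z 0) / W * Y n := by
    refine SolvesRec.ext hZ (hX.comb hY _ _) ?_ ?_
    · field_simp; rw [hWdef]; ring
    · field_simp; rw [hWdef]; ring
  generalize (Z 0 * Y 1 - Z 1 * Y 0) / W = s at hZeq
  generalize (X 0 * Z 1 - X 1 * Z 0) / W = t at hZeq
  have hs : s ≠ 0 := by
    rintro rfl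
    exact hZn ⟨t, fun n => by rw [hZeq n]; ring⟩
  have hZlim : Tendsto (fun n => (-1) ^ n * Z n) atTop (𝓝 (s * L)) := by
    have := (hXL.const_mul s).add (hY0.const_mul t)
    rw [mul_zero, add_zero] at this
    refine this.congr fun n => ?_
    rw [hZeq n]; ring
  have hsL := mul_ne_zero hs hL
  refine ⟨(hZlim.eventually_ne hsL).mono fun n hn h => hn (by rw [h, mul_zero]), ?_⟩
  have := hY0.div hZlim hsL
  rw [zero_div] at this
  refine this.congr fun n => ?_
  exact mul_div_mul_left _ _ (pow_ne_zero _ (by norm_num))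

/-- Pincherle's theorem. -/
lemma fracConvergesTo_of_isMinimalSolution {γ δ Y : ℕ → ℂ} (hY : IsMinimalSolution γ δ Y)
    (h : γ 0 * Y 0 - Y 1 ≠ 0) :
    FracConvergesTo (recFrac γ δ) (Y 0 / (γ 0 * Y 0 - Y 1)) := by
  set g := recFrac γ δ with hg
  have hs : ∀ n, g.s.get? n = some ⟨if n = 0 then 1 else -δ n, γ n⟩ := fun n => rfl
  have hh : g.h = 0 := rfl
  have hX0 : g.dens 0 = 1 := GenContFract.zeroth_den_eq_one
  have hX1 : g.dens 1 = γ 0 := GenContFract.first_den_eq (hs 0)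
  have hA0 : g.nums 0 = 0 := by rw [GenContFract.zeroth_num_eq_h, hh]
  have hA1 : g.nums 1 = 1 := by
    rw [GenContFract.first_num_eq (hs 0), hh]; simp
  have hX : SolvesRec γ δ g.dens := fun n => by
    have := GenContFract.dens_recurrence (hs (n + 1)) rfl rfl
    simp only [Nat.succ_ne_zero, if_false] at this
    rw [this]; ring
  have hA : SolvesRec γ δ g.nums := fun n => by
    have := GenContFract.nums_recurrence (hs (n + 1)) rfl rfl
    simp only [Nat.succ_ne_zero, if_false] at this
    rw [this]; ring
  -- Denominators proportional to Y, with initial values 1 and γ 0, would force γ 0 * Y 0 = Y 1.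
  obtain ⟨hne, hlim⟩ := hY.2.2 g.dens hX fun ⟨t, ht⟩ => h <| by
    have e0 := ht 0
    have e1 := ht 1
    rw [hX0] at e0
    rw [hX1] at e1
    rw [e1]; linear_combination -Y 1 * e0
  refine ⟨hne, ?_⟩
  -- The numerators equal the claimed value times the denominators plus a multiple of Y, so the
  -- error of the convergents is a multiple of Y/dens.
  have hAeq : ∀ n, g.nums n = Y 0 / (γ 0 * Y 0 - Y 1) * g.dens n +
      -1 / (γ 0 * Y 0 - Y 1) * Y n := by
    refine SolvesRec.ext hA (hX.comb hY.1 _ _) ?_ ?_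
    · rw [hA0, hX0]; ring
    · rw [hA1, hX1, div_mul_eq_mul_div, div_mul_eq_mul_div, ← add_div, eq_div_iff h]; ring
  have h2 := (hlim.const_mul (-1 / (γ 0 * Y 0 - Y 1))).const_add (Y 0 / (γ 0 * Y 0 - Y 1))
  rw [mul_zero, add_zero] at h2
  refine h2.congr' ?_
  filter_upwards [hne] with n hn
  rw [GenContFract.conv_eq_num_div_den, hAeq n]
  field_simp

/-! ### The recurrence of the theorem and its limits. -/

lemma reg_div {q x y : ℂ} (hy : y ≠ 0) (h : ∀ k : ℕ, x * q ^ k ≠ y) : Reg q (x / y) := fun k e => by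
  apply h k
  field_simp at e
  exact e

lemma recC_eq {q : ℂ} (hq0 : q ≠ 0) (a b c d e h : ℂ) (n : ℤ) :
    recC q a b c d e h n = ctgC q a b c d e (h⁻¹ * q ^ n) := by
  rw [recC, ctgC, zpow_add₀ hq0, zpow_one]
  have e1 : ∀ x, a * q * (h⁻¹ * q ^ n) / x = a * (q ^ n * q) / (x * h) := fun x => by
    rw [← div_div]; ring
  rw [e1, e1, e1, e1, show a * q * (h⁻¹ * q ^ n) = a * (q ^ n * q) / h by ring]

lemma recD_eq {q : ℂ} (hq0 : q ≠ 0) (a b c d e h : ℂ) (n : ℤ) :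
    recD q a b c d e h n = ctgD q a b c d e (h⁻¹ * q ^ n) := by
  rw [recD, ctgD, zpow_add₀ hq0, zpow_one, ← div_div (a ^ 2 * (q ^ n * q))]
  ring

lemma reccn_eq {q : ℂ} (hq0 : q ≠ 0) (a b c d e h : ℂ) (n : ℤ) :
    reccn q a b c d e h n = ctgM q a b c d e (h⁻¹ * q ^ n) := by
  rw [reccn, ctgM, recC_eq hq0, recD_eq hq0, zpow_add₀ hq0, zpow_add₀ hq0, two_mul, zpow_add₀ hq0,
    zpow_one, ← div_div (a ^ 2 * (q ^ n * q ^ n * q ^ (2 : ℤ)))]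
  have : (q : ℂ) ^ (2 : ℤ) = q ^ 2 := by norm_cast
  rw [this, show a * (q ^ n * q) / h = a * q * (h⁻¹ * q ^ n) by ring]
  ring

/-- The coefficients are invariant under the involution `a ↦ bcde/(aq)`. -/
lemma ctg_involution {q a b c d e F : ℂ} (hq0 : q ≠ 0) (ha : a ≠ 0) (hb : b ≠ 0) (hc : c ≠ 0)
    (hd : d ≠ 0) (he : e ≠ 0) :
    ctgC q (b * c * d * e / (a * q)) b c d e (a ^ 2 * q / (b * c * d * e) * F) =
        ctgC q a b c d e F ∧
      ctgD q (b * c * d * e / (a * q)) b c d e (a ^ 2 * q / (b * c * d * e) * F) =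
        ctgD q a b c d e F ∧
      ctgM q (b * c * d * e / (a * q)) b c d e (a ^ 2 * q / (b * c * d * e) * F) =
        ctgM q a b c d e F := by
  have e1 : b * c * d * e / (a * q) * q * (a ^ 2 * q / (b * c * d * e) * F) = a * q * F := by
    field_simp
  have hC : ctgC q (b * c * d * e / (a * q)) b c d e (a ^ 2 * q / (b * c * d * e) * F) =
        ctgC q a b c d e F := by rw [ctgC, ctgC, e1]
  -- The involution fixes aF and exchanges F with a²qF/(bcde), so it only permutes the factors of D.
  have hD : ctgD q (b * c * d * e / (a * q)) b c d e (a ^ 2 * q / (b * c * d * e) * F) =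
        ctgD q a b c d e F := by
    rw [ctgD, ctgD, show b * c * d * e / (a * q) * (a ^ 2 * q / (b * c * d * e) * F) = a * F by
      field_simp, show (b * c * d * e / (a * q)) ^ 2 * q * (a ^ 2 * q / (b * c * d * e) * F) /
        (b * c * d * e) = F by field_simp]
    ring
  refine ⟨hC, hD, ?_⟩
  rw [ctgM, ctgM, hC, hD, e1, show (b * c * d * e / (a * q)) ^ 2 * q ^ 2 *
    (a ^ 2 * q / (b * c * d * e) * F) ^ 2 / (b * c * d * e) =
      a ^ 2 * q ^ 2 * F ^ 2 / (b * c * d * e) by field_simp]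

lemma solPre_succ {q a b c d e h : ℂ} (hq0 : q ≠ 0) (hq : ‖q‖ < 1) (hb : Reg q (a * q / (b * h)))
    (hc : Reg q (a * q / (c * h))) (hd : Reg q (a * q / (d * h))) (he : Reg q (a * q / (e * h)))
    (hh : Reg q (a * q / h)) (n : ℕ) :
    solPre q a b c d e h (n + 1 : ℕ) = recC q a b c d e h n * solPre q a b c d e h n := by
  have e0 : ∀ x, a * q ^ ((n : ℤ) + 1) / x = a * q / x * q ^ n := fun x => by
    rw [zpow_add₀ hq0, zpow_one, zpow_natCast]; ring
  have e1 : ∀ x, a * q ^ (((n + 1 : ℕ) : ℤ) + 1) / x = a * q / x * q ^ n * q := fun x => by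
    rw [zpow_add₀ hq0, zpow_one, zpow_natCast]; ring
  simp only [solPre, recC, e0, e1, qPochInfs, List.map_cons, List.map_nil, List.prod_cons,
    List.prod_nil, mul_one]
  have h1 : ∀ {x}, Reg q x → 1 - x * q ^ n ≠ 0 ∧ qPochInf q (x * q ^ n * q) ≠ 0 ∧
      qPochInf q (x * q ^ n) = (1 - x * q ^ n) * qPochInf q (x * q ^ n * q) := fun hx =>
    ⟨hx.one_sub_ne n, qPochInf_ne_zero hq (hx.mul_pow n).mul_self, qPochInf_eq_mul hq _⟩
  obtain ⟨b1, b2, b3⟩ := h1 hb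
  obtain ⟨c1, c2, c3⟩ := h1 hc
  obtain ⟨d1, d2, d3⟩ := h1 hd
  obtain ⟨f1, f2, f3⟩ := h1 he
  obtain ⟨g1, g2, g3⟩ := h1 hh
  rw [b3, c3, d3, f3, g3, show (-1 : ℂ) ^ ((n + 1 : ℕ) : ℤ) = -(-1) ^ (n : ℤ) by
    rw [zpow_natCast, zpow_natCast, pow_succ]; ring]
  generalize qPochInf q (a * q / (b * h) * q ^ n * q) = xb,
    qPochInf q (a * q / (c * h) * q ^ n * q) = xc, qPochInf q (a * q / (d * h) * q ^ n * q) = xd,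
    qPochInf q (a * q / (e * h) * q ^ n * q) = xe, qPochInf q (a * q / h * q ^ n * q) = xh at *
  generalize 1 - a * q / (b * h) * q ^ n = yb, 1 - a * q / (c * h) * q ^ n = yc,
    1 - a * q / (d * h) * q ^ n = yd, 1 - a * q / (e * h) * q ^ n = ye,
    1 - a * q / h * q ^ n = yh at *
  field_simp

lemma tendsto_solPre {q : ℂ} (hq0 : q ≠ 0) (hq : ‖q‖ < 1) (a b c d e h : ℂ) :
    Tendsto (fun n : ℕ => (-1) ^ n * solPre q a b c d e h n) atTop (𝓝 1) := by
  have hI : ∀ x, Tendsto (fun n : ℕ => qPochInf q (a * q ^ ((n : ℤ) + 1) / x)) atTop (𝓝 1) :=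
    fun x => by
    have h1 : Tendsto (fun n : ℕ => a * q / x * q ^ n) atTop (𝓝 0) := by
      simpa using (tendsto_pow_atTop_nhds_zero_of_norm_lt_one hq).const_mul (a * q / x)
    have h2 := ((differentiable_qPochInf hq).continuous.tendsto 0).comp h1
    rw [show qPochInf q 0 = 1 by simp [qPochInf]] at h2
    refine h2.congr fun n => ?_
    simp only [Function.comp]
    congr 1
    rw [zpow_add₀ hq0, zpow_one, zpow_natCast]; ring
  have := (hI h).div ((hI (b * h)).mul ((hI (c * h)).mul ((hI (d * h)).mul (hI (e * h)))))
    (by norm_num)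
  norm_num at this
  refine this.congr fun n => ?_
  simp only [solPre, qPochInfs, List.map_cons, List.map_nil, List.prod_cons, List.prod_nil,
    mul_one, zpow_natCast]
  rw [← mul_div_assoc, ← mul_assoc, ← mul_pow]
  norm_num

/-- Since F = q^n/h tends to 0, the value at F = 0 is what appears as the limit of the first
solution. -/
lemma constC1_eq_wSum {q a b c d e : ℂ} (hq0 : q ≠ 0) (hq : ‖q‖ < 1)
    (hr : BaseReg q a b c d e) (hde : Reg q (a * q / (d * e))) :
    constC1 q a b c d e = wSum q a b c d e 0 := by
  have h1 := qPochInf_ne_zero hq hr.low_d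
  have h2 := qPochInf_ne_zero hq hr.low_e
  simp only [constC1, qPochInfs, List.map_cons, List.map_nil, List.prod_cons, List.prod_nil,
    mul_one]
  rw [div_mul_eq_mul_div, ← wSum_zero hq0 hq hr hde, mul_div_cancel_right₀ _ (mul_ne_zero h1 h2)]

lemma constC3_eq_constC1 {q a b c d e : ℂ} (hq0 : q ≠ 0) (ha : a ≠ 0) (hb : b ≠ 0) (hc : c ≠ 0)
    (hd : d ≠ 0) (he : e ≠ 0) :
    constC3 q a b c d e = constC1 q (b * c * d * e / (a * q)) b c d e := by
  have h : b * c * d * e / (a * q) * q = b * c * d * e / a := by field_simp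
  rw [constC3, constC1, h, show b * c * d * e / a / (d * e) = b * c / a by field_simp,
    show b * c * d * e / a / d = b * c * e / a by field_simp,
    show b * c * d * e / a / e = b * c * d / a by field_simp,
    show b * c * d * e / a / (b * c) = d * e / a by field_simp,
    show b * c * d * e / a / b = c * d * e / a by field_simp,
    show b * c * d * e / a / c = b * d * e / a by field_simp]
  simp only [qPochInfs, List.map_cons, List.map_nil, List.prod_cons, List.prod_nil, mul_one]
  rw [mul_comm (qPochInf q (b * c * d / a))]

lemma tendsto_wSum {q a b c d e : ℂ} (hq0 : q ≠ 0) (hq : ‖q‖ < 1) (hr : BaseReg q a b c d e)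
    (v : ℂ) : Tendsto (fun n : ℕ => wSum q a b c d e (v * q ^ n)) atTop
      (𝓝 (wSum q a b c d e 0)) := by
  set U : Set ℂ := {F | Reg q (a ^ 2 * q ^ 2 / (b * c * d * e) * F)} ∩ {F | Reg q (a * q * F)}
  have hU : IsOpen U := (isOpen_setOf_reg_mul hq _).inter (isOpen_setOf_reg_mul hq _)
  have hd := differentiableOn_wSum hq0 hq hr 1 hU (fun F h => by rw [mul_one]; exact h.1)
    (fun F h => by rw [mul_one]; exact h.2)
  simp only [mul_one] at hd
  have hc : ContinuousAt (wSum q a b c d e) 0 :=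
    hd.continuousOn.continuousAt (hU.mem_nhds ⟨reg_zero_mem q _, reg_zero_mem q _⟩)
  have h1 : Tendsto (fun n : ℕ => v * q ^ n) atTop (𝓝 0) := by
    simpa using (tendsto_pow_atTop_nhds_zero_of_norm_lt_one hq).const_mul v
  exact hc.tendsto.comp h1

lemma Reg.congr {q x y : ℂ} (h : Reg q x) (e : y = x) : Reg q y := e ▸ h

lemma reg_of_ne {q x y z : ℂ} (hy : y ≠ 0) (h : ∀ k : ℕ, x * q ^ k ≠ y) (e : z = x / y) :
    Reg q z := e ▸ reg_div hy h

/-- The prefactor has ratio C_n. Multiplying by it normalizes the leading coefficient C_n to 1 and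
is the source of d_n = C_{n-1}D_n. -/
lemma solvesRec_mul {q a b c d e h : ℂ} {w : ℕ → ℂ}
    (hpre : ∀ n : ℕ, solPre q a b c d e h (n + 1 : ℕ) =
      recC q a b c d e h n * solPre q a b c d e h n)
    (hw : ∀ n : ℕ, recC q a b c d e h (n + 1 : ℕ) * w (n + 2) -
      reccn q a b c d e h (n + 1 : ℕ) * w (n + 1) + recD q a b c d e h (n + 1 : ℕ) * w n = 0) :
    SolvesRec (fun n : ℕ => reccn q a b c d e h n) (fun n : ℕ => recdn q a b c d e h n)
      fun n : ℕ => solPre q a b c d e h n * w n := fun n => by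
  have h1 := hpre n
  have h2 := hpre (n + 1)
  have h3 : recdn q a b c d e h (n + 1 : ℕ) =
      recC q a b c d e h n * recD q a b c d e h (n + 1 : ℕ) := by
    rw [recdn]; congr 2; push_cast; ring
  simp only [h3]
  rw [show n + 2 = n + 1 + 1 from rfl, h2, h1]
  linear_combination recC q a b c d e h n * solPre q a b c d e h n * hw n

lemma wSum_swap_swap (q a b c d e F : ℂ) : wSum q a c b e d F = wSum q a b c d e F := by
  have h : a ^ 2 * q ^ 2 / (c * b * e * d) = a ^ 2 * q ^ 2 / (b * c * d * e) := by
    congr 1; ring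
  rw [wSum, wSum, h, vwpSum, vwpSum]
  refine congrArg₂ (contVal q 8) ?_ ?_
  · rw [vwpNum, vwpNum]; ring
  · rw [vwpDen, vwpDen]; ring

/-- The function in `Y^{(3)}` in terms of the very-well-poised series with base `aq/h²`. -/
lemma wSum_involution_eq {q a b c d e h : ℂ} (hq0 : q ≠ 0) (hq : ‖q‖ < 1) (ha : a ≠ 0)
    (hh : h ≠ 0) (hr : BaseReg q (b * c * d * e / (a * q)) b c d e) (hah : Reg q (a * q / h))
    (hz : Reg q (q / h)) (hb : Reg q (b * q / h)) (hc : Reg q (c * q / h))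
    (hd : Reg q (d * q / h)) (he : Reg q (e * q / h))
    (hh' : Reg q (b * c * d * e * h / (a ^ 2 * q))) (hm : Reg q (a * q / h ^ 2)) :
    wSum q (b * c * d * e / (a * q)) b c d e (b * c * d * e * h / (a ^ 2 * q))⁻¹ =
      qPochInfs q [b * c * d * e / a, b * c * d * e * h / (a ^ 2 * q),
          b * q / h, c * q / h, d * q / h, e * q / h] /
        qPochInfs q [b * d * e / a, b * c * e / a, b * c * d / a, c * d * e / a,
          a * q ^ 2 / h ^ 2, q / h] *
      W87 q (a * q / h ^ 2) (a * q / (b * h)) (a * q / (c * h)) (a * q / (d * h))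
        (a * q / (e * h)) (q / h) (b * c * d * e * h / (a ^ 2 * q)) := by
  have hb0 := hr.b_ne
  have hc0 := hr.c_ne
  have hd0 := hr.d_ne
  have he0 := hr.e_ne
  have hmb : BaseReg q (a * q / h ^ 2) (a * q / (b * h)) (a * q / (c * h)) (a * q / (d * h))
      (a * q / (e * h)) :=
    { a_ne := by positivity
      b_ne := by positivity
      c_ne := by positivity
      d_ne := by positivity
      e_ne := by positivity
      base := hm.sq
      low_b := hb.congr (by field_simp)
      low_c := hc.congr (by field_simp)
      low_d := hd.congr (by field_simp)
      low_e := he.congr (by field_simp) }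
  have hrb : BaseReg q (b * c * d * e / (a * q)) (b * c * d * e * h / (a ^ 2 * q)) b c d :=
    { a_ne := hr.a_ne
      b_ne := by positivity
      c_ne := hb0
      d_ne := hc0
      e_ne := hd0
      base := hr.base
      low_b := hah.congr (by field_simp)
      low_c := hr.low_b
      low_d := hr.low_c
      low_e := hr.low_d }
  -- The parameter containing h is put in the distinguished slot; this makes the argument q/h and
  -- the new base aq/h².
  have key := wSum_transform₂ (m := a * q / h ^ 2) (z := q / h) hq0 hq hrb he0 (by field_simp)
    (by field_simp) hr.low_e hz (hb.congr (by ring)) (hc.congr (by ring)) (hd.congr (by ring))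
    (he.congr (by ring)) hh' hm.sq
  have hh0 : b * c * d * e * h / (a ^ 2 * q) ≠ 0 := hrb.b_ne
  rw [← wSum_rotate he0 hh0] at key
  rw [W87_eq_wSum hq0 hq hmb (by positivity) (hah.congr (by field_simp)) hh' (by field_simp)]
  have f1 : ∀ x, x ≠ 0 → b * c * d * e / (a * q) * q / (b * c * d * e * h / (a ^ 2 * q) * x) =
      a * q / (x * h) := fun x hx => by field_simp
  rw [f1 b hb0, f1 c hc0, f1 d hd0, f1 e he0,
    show b * c * d * e / (a * q) * q / b = c * d * e / a by field_simp,
    show b * c * d * e / (a * q) * q / c = b * d * e / a by field_simp,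
    show b * c * d * e / (a * q) * q / d = b * c * e / a by field_simp,
    show b * c * d * e / (a * q) * q / e = b * c * d / a by field_simp,
    show b * c * d * e / (a * q) * q = b * c * d * e / a by field_simp,
    show a * q / h ^ 2 * q = a * q ^ 2 / h ^ 2 by ring,
    ← mul_div_assoc, ← mul_div_assoc, ← mul_div_assoc, ← mul_div_assoc] at key
  have n1 := qPochInf_ne_zero hq (hr.low_b.congr (y := c * d * e / a) (by field_simp))
  have n2 := qPochInf_ne_zero hq (hr.low_c.congr (y := b * d * e / a) (by field_simp))
  have n3 := qPochInf_ne_zero hq (hr.low_d.congr (y := b * c * e / a) (by field_simp))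
  have n4 := qPochInf_ne_zero hq (hr.low_e.congr (y := b * c * d / a) (by field_simp))
  have n5 := qPochInf_ne_zero hq (hm.mul_self.congr (y := a * q ^ 2 / h ^ 2) (by ring))
  have n6 := qPochInf_ne_zero hq hz
  simp only [qPochInfs, List.map_cons, List.map_nil, List.prod_cons, List.prod_nil, mul_one]
  rw [div_mul_eq_mul_div, eq_div_iff (by simp [n1, n2, n3, n4, n5, n6])]
  rw [wSum_swap_swap q (a * q / h ^ 2)] at key
  linear_combination key

/-! ### Assembly. -/

theorem theorem5p1 (q a b c d e h : ℂ)
    (hq0 : q ≠ 0) (hq1 : ‖q‖ < 1)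
    (ha : a ≠ 0) (hb : b ≠ 0) (hc : c ≠ 0) (hd : d ≠ 0) (he : e ≠ 0) (hh : h ≠ 0)
    (h_sqrt1 : ∀ k : ℕ, a * q ^ (2 * k) ≠ 1)
    (h_low1 : ∀ k : ℕ, a * q ^ (k + 1) ≠ b ∧ a * q ^ (k + 1) ≠ c ∧
      a * q ^ (k + 1) ≠ d ∧ a * q ^ (k + 1) ≠ e)
    (h_ah : ∀ k : ℕ, a * q ^ (k + 1) ≠ h)
    (h_pre : ∀ k : ℕ, a * q ^ (k + 1) ≠ b * h ∧ a * q ^ (k + 1) ≠ c * h ∧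
      a * q ^ (k + 1) ≠ d * h ∧ a * q ^ (k + 1) ≠ e * h)
    (h_arg1 : ∀ k : ℕ, a ^ 2 * q ^ (k + 2) ≠ b * c * d * e * h)
    (h_arg3 : ∀ k : ℕ, q ^ (k + 1) ≠ h)
    (h_sqrt3 : ∀ k : ℕ, b * c * d * e * q ^ (2 * k) ≠ a * q)
    (h_low3 : ∀ k : ℕ, b * c * d * q ^ k ≠ a ∧ b * c * e * q ^ k ≠ a ∧
      b * d * e * q ^ k ≠ a ∧ c * d * e * q ^ k ≠ a)
    (h_C1 : ∀ k : ℕ, a * q ^ (k + 1) ≠ d * e)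
    (h_C3 : ∀ k : ℕ, b * c * q ^ k ≠ a)
    (h_den : reccn q a b c d e h 0 * solMin q a b c d e h 0 - solMin q a b c d e h 1 ≠ 0) :
    IsMinimalSolution (fun n : ℕ => reccn q a b c d e h n) (fun n : ℕ => recdn q a b c d e h n)
        (fun n : ℕ => solMin q a b c d e h n) ∧
    FracConvergesTo
        (recFrac (fun n : ℕ => reccn q a b c d e h n) (fun n : ℕ => recdn q a b c d e h n))
        (solMin q a b c d e h 0 /
          (reccn q a b c d e h 0 * solMin q a b c d e h 0 - solMin q a b c d e h 1)) ∧
    (h ≠ 1 → a ≠ h →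
      (∀ k : ℕ, b * q ^ k ≠ h ∧ c * q ^ k ≠ h ∧ d * q ^ k ≠ h ∧ e * q ^ k ≠ h) →
      (∀ k : ℕ, a * q ^ k ≠ h ^ 2 * q) →
      (∀ k : ℕ, b * c * d * e * h * q ^ k ≠ a ^ 2 * q) →
      valDen q a b c d e h ≠ 0 ∧
      solMin q a b c d e h 0 /
          (reccn q a b c d e h 0 * solMin q a b c d e h 0 - solMin q a b c d e h 1) =
        -(1 / (q * (1 - 1 / h) * (1 - a ^ 2 * q / (b * c * d * e * h)) * (1 - a / h))) *
          (valNum q a b c d e h / valDen q a b c d e h)) := by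
  have ha' : b * c * d * e / (a * q) ≠ 0 := by positivity
  have hr1 : BaseReg q a b c d e :=
    { a_ne := ha
      b_ne := hb
      c_ne := hc
      d_ne := hd
      e_ne := he
      base := fun k => by rw [← pow_mul]; exact h_sqrt1 k
      low_b := reg_div hb fun k => by rw [mul_assoc, ← pow_succ']; exact (h_low1 k).1
      low_c := reg_div hc fun k => by rw [mul_assoc, ← pow_succ']; exact (h_low1 k).2.1
      low_d := reg_div hd fun k => by rw [mul_assoc, ← pow_succ']; exact (h_low1 k).2.2.1
      low_e := reg_div he fun k => by rw [mul_assoc, ← pow_succ']; exact (h_low1 k).2.2.2 }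
  have hr3 : BaseReg q (b * c * d * e / (a * q)) b c d e :=
    { a_ne := ha'
      b_ne := hb
      c_ne := hc
      d_ne := hd
      e_ne := he
      base := reg_div (by positivity) fun k => by rw [← pow_mul]; exact h_sqrt3 k
      low_b := reg_of_ne ha (fun k => (h_low3 k).2.2.2) (by field_simp)
      low_c := reg_of_ne ha (fun k => (h_low3 k).2.2.1) (by field_simp)
      low_d := reg_of_ne ha (fun k => (h_low3 k).2.1) (by field_simp)
      low_e := reg_of_ne ha (fun k => (h_low3 k).1) (by field_simp) }
  have r_ah : Reg q (a * q / h) := reg_div hh fun k => by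
    rw [mul_assoc, ← pow_succ']; exact h_ah k
  have r_z1 : Reg q (a ^ 2 * q ^ 2 / (b * c * d * e * h)) := reg_div (by positivity) fun k => by
    rw [mul_assoc, ← pow_add, add_comm]; exact h_arg1 k
  have r_z3 : Reg q (q / h) := reg_div hh fun k => by rw [← pow_succ']; exact h_arg3 k
  set v := a ^ 2 * q / (b * c * d * e) with hv
  set w1 := fun F => wSum q a b c d e F with hw1
  -- The involution rescales F by v, so `w1` and `w3` satisfy one and the same relation in F.
  set w3 := fun F => wSum q (b * c * d * e / (a * q)) b c d e (v * F) with hw3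
  have hpre := solPre_succ (q := q) (a := a) (b := b) (c := c) (d := d) (e := e) (h := h) hq0 hq1
    (reg_div (by positivity) fun k => by rw [mul_assoc, ← pow_succ']; exact (h_pre k).1)
    (reg_div (by positivity) fun k => by rw [mul_assoc, ← pow_succ']; exact (h_pre k).2.1)
    (reg_div (by positivity) fun k => by rw [mul_assoc, ← pow_succ']; exact (h_pre k).2.2.1)
    (reg_div (by positivity) fun k => by rw [mul_assoc, ← pow_succ']; exact (h_pre k).2.2.2) r_ah
  have ctg1 : ∀ F, Reg q (a * F) → Reg q (v * F) →
      ctgC q a b c d e F * w1 (F * q) - ctgM q a b c d e F * w1 F +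
        ctgD q a b c d e F * w1 (F / q) = 0 := fun F h1 h2 => wSum_contiguous hq0 hq1 hr1 h1 h2
  have ctg3 : ∀ F, Reg q (a * F) → Reg q F →
      ctgC q a b c d e F * w3 (F * q) - ctgM q a b c d e F * w3 F +
        ctgD q a b c d e F * w3 (F / q) = 0 := fun F h1 h2 => by
    obtain ⟨hC, hD, hM⟩ := ctg_involution (F := F) hq0 ha hb hc hd he
    have := wSum_contiguous (F := v * F) hq0 hq1 hr3 (h1.congr (by rw [hv]; field_simp))
      (h2.congr (by rw [hv]; field_simp))
    rw [hC, hD, hM] at this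
    rw [hw3]
    simpa only [mul_assoc, mul_div_assoc] using this
  have e1 : ∀ n : ℕ, sol1 q a b c d e h n = solPre q a b c d e h n * w1 (h⁻¹ * q ^ n) := fun n => by
    rw [sol1, W87_eq_wSum hq0 hq1 hr1 (by positivity) ((r_ah.mul_pow n).congr ?_)
      ((r_z1.mul_pow n).congr ?_) ?_, mul_inv, zpow_neg, inv_inv, zpow_natCast]
    · rw [zpow_neg, zpow_natCast]; field_simp
    · rw [zpow_add₀ hq0, zpow_natCast]; norm_cast; ring
    · rw [zpow_add₀ hq0, zpow_neg, zpow_natCast]; norm_cast; field_simp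
  have e3 : ∀ n : ℕ, sol3 q a b c d e h n = solPre q a b c d e h n * w3 (h⁻¹ * q ^ n) := fun n => by
    have hf : b * c * d * e * h * q ^ (-(n : ℤ) - 1) / a ^ 2 = (v * (h⁻¹ * q ^ n))⁻¹ := by
      rw [zpow_sub₀ hq0, zpow_neg, zpow_natCast, zpow_one, hv]; field_simp
    have hz : q ^ ((n : ℤ) + 1) / h = q / h * q ^ n := by
      rw [zpow_add₀ hq0, zpow_natCast, zpow_one]; ring
    rw [sol3, hf, hz, W87_eq_wSum hq0 hq1 hr3 (by positivity) ((r_ah.mul_pow n).congr ?_)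
      (r_z3.mul_pow n) ?_, inv_inv]
    · rw [hv]; field_simp
    · rw [hv]; field_simp
  have r_aF : ∀ n : ℕ, Reg q (a * (h⁻¹ * q ^ (n + 1))) := fun n =>
    (r_ah.mul_pow n).congr (by field_simp; ring)
  have s1 : SolvesRec (fun n : ℕ => reccn q a b c d e h n) (fun n : ℕ => recdn q a b c d e h n)
      fun n : ℕ => sol1 q a b c d e h n := by
    simp only [e1]
    refine solvesRec_mul hpre fun n => ?_
    have := ctg1 (h⁻¹ * q ^ (n + 1)) (r_aF n) ((r_z1.mul_pow n).congr (by rw [hv]; field_simp; ring))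
    rw [recC_eq hq0, recD_eq hq0, reccn_eq hq0, zpow_natCast, pow_succ q (n + 1), ← mul_assoc]
    rwa [show h⁻¹ * q ^ (n + 1) / q = h⁻¹ * q ^ n by rw [pow_succ]; field_simp] at this
  have s3 : SolvesRec (fun n : ℕ => reccn q a b c d e h n) (fun n : ℕ => recdn q a b c d e h n)
      fun n : ℕ => sol3 q a b c d e h n := by
    simp only [e3]
    refine solvesRec_mul hpre fun n => ?_
    have := ctg3 (h⁻¹ * q ^ (n + 1)) (r_aF n) ((r_z3.mul_pow n).congr (by field_simp; ring))
    rw [recC_eq hq0, recD_eq hq0, reccn_eq hq0, zpow_natCast, pow_succ q (n + 1), ← mul_assoc]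
    rwa [show h⁻¹ * q ^ (n + 1) / q = h⁻¹ * q ^ n by rw [pow_succ]; field_simp] at this
  have l1 : Tendsto (fun n : ℕ => (-1) ^ n * sol1 q a b c d e h n) atTop
      (𝓝 (constC1 q a b c d e)) := by
    rw [constC1_eq_wSum hq0 hq1 hr1 (reg_div (by positivity) fun k => by
      rw [mul_assoc, ← pow_succ']; exact h_C1 k)]
    have := (tendsto_solPre hq0 hq1 a b c d e h).mul (tendsto_wSum hq0 hq1 hr1 h⁻¹)
    rw [one_mul] at this
    refine this.congr fun n => ?_
    rw [e1, mul_assoc]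
  have l3 : Tendsto (fun n : ℕ => (-1) ^ n * sol3 q a b c d e h n) atTop
      (𝓝 (constC3 q a b c d e)) := by
    rw [constC3_eq_constC1 hq0 ha hb hc hd he, constC1_eq_wSum hq0 hq1 hr3
      (reg_of_ne ha h_C3 (by field_simp))]
    have := (tendsto_solPre hq0 hq1 a b c d e h).mul (tendsto_wSum hq0 hq1 hr3 (v * h⁻¹))
    rw [one_mul] at this
    refine this.congr fun n => ?_
    rw [e3, mul_assoc, mul_assoc v]
  have sMin : SolvesRec (fun n : ℕ => reccn q a b c d e h n) (fun n : ℕ => recdn q a b c d e h n)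
      fun n : ℕ => solMin q a b c d e h n := by
    have := s1.comb s3 (constC3 q a b c d e) (-constC1 q a b c d e)
    simpa only [solMin, neg_mul, ← sub_eq_add_neg] using this
  have lMin : Tendsto (fun n : ℕ => (-1) ^ n * solMin q a b c d e h n) atTop (𝓝 0) := by
    have := (l1.const_mul (constC3 q a b c d e)).sub (l3.const_mul (constC1 q a b c d e))
    rw [mul_comm (constC1 q a b c d e), sub_self] at this
    refine this.congr fun n => ?_
    rw [solMin]; ring
  have hne : ∃ n : ℕ, solMin q a b c d e h n ≠ 0 := by
    by_contra! H
    have h0 := H 0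
    have h1 := H 1
    push_cast at h0 h1
    exact h_den (by rw [h0, h1]; ring)
  have hmin : IsMinimalSolution (fun n : ℕ => reccn q a b c d e h n)
      (fun n : ℕ => recdn q a b c d e h n) (fun n : ℕ => solMin q a b c d e h n) := by
    -- Either limit may vanish, but not both, since Y^(min) would then be zero; the solution with
    -- nonzero limit serves for comparison.
    by_cases hC1 : constC1 q a b c d e = 0
    · have hC3 : constC3 q a b c d e ≠ 0 := fun hC3 => by
        obtain ⟨n, hn⟩ := hne
        exact hn (by rw [solMin, hC1, hC3]; ring)
      exact isMinimalSolution_of_tendsto s3 sMin hC3 l3 lMin hne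
    · exact isMinimalSolution_of_tendsto s1 sMin hC1 l1 lMin hne
  refine ⟨hmin, ?_, fun hh1 hah hxh hah2 hbcde => ?_⟩
  · have := fracConvergesTo_of_isMinimalSolution hmin (by exact_mod_cast h_den)
    exact_mod_cast this
  have r_h' : Reg q (b * c * d * e * h / (a ^ 2 * q)) := reg_div (by positivity) hbcde
  have r_ah0 : Reg q (a / h) := reg_of_mul (by rwa [ne_eq, div_eq_one_iff_eq hh])
    (r_ah.congr (by ring))
  have r_h0 : Reg q (1 / h) := reg_of_mul (by rwa [ne_eq, div_eq_one_iff_eq hh, eq_comm])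
    (r_z3.congr (by ring))
  have r_z0 : Reg q (a ^ 2 * q / (b * c * d * e * h)) := by
    refine reg_of_mul ?_ (r_z1.congr (by ring))
    rw [ne_eq, div_eq_one_iff_eq (by positivity), eq_comm]
    simpa using hbcde 0
  have r_m : Reg q (a / (h ^ 2 * q)) := reg_div (by positivity) hah2
  have r_b : Reg q (b / h) := reg_div hh fun k => (hxh k).1
  have r_c : Reg q (c / h) := reg_div hh fun k => (hxh k).2.1
  have r_d : Reg q (d / h) := reg_div hh fun k => (hxh k).2.2.1
  have r_e : Reg q (e / h) := reg_div hh fun k => (hxh k).2.2.2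
  have hN : valNum q a b c d e h =
      constC3 q a b c d e * w1 h⁻¹ - constC1 q a b c d e * w3 h⁻¹ := by
    have := wSum_involution_eq hq0 hq1 ha hh hr3 r_ah r_z3 (r_b.mul_self.congr (by ring))
      (r_c.mul_self.congr (by ring)) (r_d.mul_self.congr (by ring))
      (r_e.mul_self.congr (by ring)) r_h' ((r_m.mul_pow 2).congr (by field_simp))
    rw [show (b * c * d * e * h / (a ^ 2 * q))⁻¹ = v * h⁻¹ by rw [hv]; field_simp] at this
    rw [valNum, W87_eq_wSum hq0 hq1 hr1 hh r_ah r_z1 rfl, mul_assoc (constC1 q a b c d e), ← this]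
  -- This is the identity for the numerator with h replaced by hq, that is, F = 1/h replaced by F/q.
  have hM : valDen q a b c d e h =
      constC3 q a b c d e * w1 (h⁻¹ / q) - constC1 q a b c d e * w3 (h⁻¹ / q) := by
    have hx : ∀ x, x * q / (h * q) = x / h := fun x => mul_div_mul_right _ _ hq0
    have hy : ∀ x, a * q / (x * (h * q)) = a / (x * h) := fun x => by
      rw [← mul_assoc, mul_div_mul_right _ _ hq0]
    have hmq : a * q / (h * q) ^ 2 = a / (h ^ 2 * q) := by field_simp
    have hmq' : a * q ^ 2 / (h * q) ^ 2 = a / h ^ 2 := by field_simp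
    have hz' : q / (h * q) = 1 / h := by field_simp
    have hh' : b * c * d * e * (h * q) / (a ^ 2 * q) = b * c * d * e * h / a ^ 2 := by field_simp
    have := wSum_involution_eq (h := h * q) hq0 hq1 ha (by positivity) hr3 (r_ah0.congr (hx a))
      (r_h0.congr hz') (r_b.congr (hx b)) (r_c.congr (hx c)) (r_d.congr (hx d)) (r_e.congr (hx e))
      (r_h'.mul_self.congr (by field_simp)) (r_m.congr hmq)
    rw [hx, hx, hx, hx, hy, hy, hy, hy, hmq, hmq', hz', hh',
      show (b * c * d * e * h / a ^ 2)⁻¹ = v * (h⁻¹ / q) by rw [hv]; field_simp] at this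
    rw [valDen, W87_eq_wSum hq0 hq1 hr1 (by positivity) (r_ah0.congr (hx a)) r_z0 (by field_simp),
      mul_assoc (constC1 q a b c d e), ← this, mul_inv, div_eq_mul_inv h⁻¹]
  have e1' := e1 0
  have e3' := e3 0
  have e1'' := e1 1
  have e3'' := e3 1
  have hpre' := hpre 0
  simp only [Nat.cast_zero, Nat.cast_one, pow_zero, pow_one, mul_one, zero_add] at e1' e3' e1'' e3'' hpre'
  have hY0 : solMin q a b c d e h 0 = solPre q a b c d e h 0 * valNum q a b c d e h := by
    rw [solMin, e1', e3', hN]; ring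
  have c1 := ctg1 h⁻¹ r_ah0 (r_z0.congr (by rw [hv]; field_simp))
  have c3 := ctg3 h⁻¹ r_ah0 (r_h0.congr (one_div h).symm)
  -- The relations in F are used at F = 1/h instead of the recurrence at n = 0: the prefactor at n =
  -- -1 may be singular, because a = xh with x among b, c, d, e is not excluded.
  have hY1 : reccn q a b c d e h 0 * solMin q a b c d e h 0 - solMin q a b c d e h 1 =
      solPre q a b c d e h 0 * (ctgD q a b c d e h⁻¹ * valDen q a b c d e h) := by
    rw [hY0, hN, hM, solMin, e1'', e3'', hpre', recC_eq hq0, reccn_eq hq0, zpow_zero, mul_one]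
    linear_combination -solPre q a b c d e h 0 * constC3 q a b c d e * c1 +
      solPre q a b c d e h 0 * constC1 q a b c d e * c3
  have hD : ctgD q a b c d e h⁻¹ =
      -(q * (1 - 1 / h) * (1 - a ^ 2 * q / (b * c * d * e * h)) * (1 - a / h)) := by
    rw [ctgD, ← div_div (a ^ 2 * q)]; ring
  rw [hY1] at h_den ⊢
  rw [hY0, mul_div_mul_left _ _ (left_ne_zero_of_mul h_den), hD]
  refine ⟨right_ne_zero_of_mul (right_ne_zero_of_mul h_den), ?_⟩
  rw [mul_comm, ← div_div, div_neg, neg_mul, one_div_mul_eq_div, div_div]
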